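/- Let $\mathcal{K}$ be a triangulated category with suspension $\Sigma$. Let $\mathcal{E}$ be a proper class of triangles in $\mathcal{K}$, i.e. a class of distinguished triangles that is closed under isomorphisms, under $\Sigma^{n}$ for all $n\in\mathbb{Z}$, under finite direct sums and under retracts, and that contains the trivial triangles $X\xrightarrow{\mathrm{id}}X\to 0\to\Sigma X$ and $0\to Y\xrightarrow{\mathrm{id}}Y\to 0$; moreover $\mathcal{E}$-monomorphisms (first maps of triangles of $\mathcal{E}$) are closed under homotopy pushouts, $\mathcal{E}$-epimorphisms (second maps of triangles of $\mathcal{E}$) are closed under homotopy pullbacks, and $\mathcal{E}$ is saturated: if a homotopy pullback of $g$ along an $\mathcal{E}$-epimorphism is an $\mathcal{E}$-epimorphism, then so is $g$. An object $P$ is $\mathcal{E}$-projective (resp. $\mathcal{E}$-injective) if $\mathcal{K}(P,-)$ (resp. $\mathcal{K}(-,P)$) sends each triangle $X\to Y\to Z\to\Sigma X$ of $\mathcal{E}$ to a short exact sequence on the terms $X,Y,Z$. Suppose that $\mathcal{E}$ is Frobenius: every object $X$ admits an $\mathcal{E}$-epimorphism $P\to X$ with $P$ $\mathcal{E}$-projective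 and an $\mathcal{E}$-monomorphism $X\to I$ with $I$ $\mathcal{E}$-injective, and $\mathrm{proj}(\mathcal{E})=\mathrm{inj}(\mathcal{E})$. Let $\pi\colon\mathcal{K}\to\mathcal{K}/\mathcal{E}$ be the relative stable category, i.e. the additive quotient of $\mathcal{K}$ by the ideal of the morphisms that factor through an object of $\mathrm{proj}(\mathcal{E})$. It is triangulated as follows. For each object $X$ choose a triangle $X\xrightarrow{\iota_X}I_X\xrightarrow{p_X}X'\xrightarrow{\delta_X}\Sigma X$ in $\mathcal{E}$ with $I_X\in\mathrm{inj}(\mathcal{E})$. The suspension of $\mathcal{K}/\mathcal{E}$ is $\Sigma_{\mathcal{E}}\pi(X)=\pi(X')$. The distinguished triangles are those isomorphic to $\pi(X)\xrightarrow{\pi f}\pi(Y)\xrightarrow{\pi g}\pi(Z)\xrightarrow{\pi h}\Sigma_{\mathcal{E}}\pi(X)$, where $f\colon X\to Y$ is a morphism of $\mathcal{K}$, $Z$ is a homotopy pushout of $f$ and $\iota_X$ with structure maps $g\colon Y\to Z$ and $z\colon I_X\to Z$, and $h\colon Z\to X'$ satisfies $hz=p_X$ and makes $Y\xrightarrow{g}Z\xrightarrow{h}X'\xrightarrow{\Sigma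 f\circ\delta_X}\Sigma Y$ a distinguished triangle of $\mathcal{K}$. A thick subcategory is a full triangulated subcategory closed under direct summands; $\mathrm{thick}(\mathrm{proj}(\mathcal{E}))$ is the smallest thick subcategory of $\mathcal{K}$ containing $\mathrm{proj}(\mathcal{E})$; $\pi(\mathcal{C})$ denotes the essential image of $\mathcal{C}$; and $/\!/$ denotes the Verdier quotient. **Theorem.** Let $\mathcal{C}$ be a full additive subcategory of $\mathcal{K}$ that is closed under direct summands and contains $\mathrm{proj}(\mathcal{E})$. 1. $\mathcal{C}$ has the $\mathcal{E}$-two-out-of-three property (for every triangle $X\to Y\to Z\to\Sigma X$ of $\mathcal{E}$, if two of $X,Y,Z$ belong to $\mathcal{C}$, then so does the third) if and only if $\pi(\mathcal{C})$ is a thick subcategory of $\mathcal{K}/\mathcal{E}$. 2. If $\mathcal{C}$ has the $\mathcal{E}$-two-out-of-three property, then $\mathcal{C}$ is a thick subcategory of $\mathcal{K}$ if and only if $\mathrm{thick}(\mathrm{proj}(\mathcal{E}))\subseteq\mathcal{C}$. 3. In that case, that is, for every thick subcategory $\mathcal{C}\subseteq\mathcal{K}$ containing $\mathrm{proj}(\mathcal{E})$,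 the subcategory $\pi(\mathcal{C})$ is thick in $\mathcal{K}/\mathcal{E}$, and $\pi$ induces an exact equivalence $\mathcal{K}/\!/\mathcal{C}\xrightarrow{\ \sim\ }(\mathcal{K}/\mathcal{E})/\!/\pi(\mathcal{C})$ of Verdier quotients, compatible (up to natural isomorphism) with $\pi$ and the two localization functors. In particular, $\mathcal{M}=\mathrm{thick}(\mathrm{proj}(\mathcal{E}))$ is thick, $\pi(\mathcal{M})$ is thick in $\mathcal{K}/\mathcal{E}$, and $\pi$ induces an exact equivalence $\mathcal{K}/\!/\mathcal{M}\simeq(\mathcal{K}/\mathcal{E})/\!/\pi(\mathcal{M})$. -/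

import Mathlib

open CategoryTheory Category Limits Pretriangulated ZeroObject

universe v u

namespace RelStable

section ShiftOfEquivalence

variable {C : Type u} [Category.{v} C]

/-- A sequence of objects indexed by `ℤ` in which each term is identified with the image of the
preceding one under the autoequivalence `e`. -/
structure Orbit (e : C ≌ C) where
  X : ℤ → C
  σ : ∀ n n' : ℤ, n + 1 = n' → (e.functor.obj (X n) ≅ X n')

namespace Orbit

variable {e : C ≌ C}

/-- Morphisms of orbits. -/
@[ext]
structure Hom (A B : Orbit e) where
  f : ∀ n : ℤ, A.X n ⟶ B.X n
  comm : ∀ (n n' : ℤ) (h : n + 1 = n'),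
    e.functor.map (f n) ≫ (B.σ n n' h).hom = (A.σ n n' h).hom ≫ f n'

instance : Category (Orbit e) where
  Hom A B := Hom A B
  id A := { f := fun n => 𝟙 _, comm := by intros; simp }
  comp {A B D} φ ψ :=
    { f := fun n => φ.f n ≫ ψ.f n
      comm := by
        intro n n' h
        rw [Functor.map_comp, assoc, ψ.comm, ← assoc, φ.comm, assoc] }
  id_comp φ := Hom.ext (by funext n; exact id_comp _)
  comp_id φ := Hom.ext (by funext n; exact comp_id _)
  assoc φ ψ χ := Hom.ext (by funext n; exact assoc _ _ _)

@[ext]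
lemma hom_ext {A B : Orbit e} (φ ψ : A ⟶ B) (h : ∀ n, φ.f n = ψ.f n) : φ = ψ :=
  Hom.ext (funext h)

@[simp] lemma id_f (A : Orbit e) (n : ℤ) : Hom.f (𝟙 A) n = 𝟙 (A.X n) := rfl
@[simp] lemma comp_f {A B D : Orbit e} (φ : A ⟶ B) (ψ : B ⟶ D) (n : ℤ) :
    (φ ≫ ψ).f n = φ.f n ≫ ψ.f n := rfl

/-- Equality of indices gives isomorphic terms. -/
def cast (A : Orbit e) {n m : ℤ} (h : n = m) : A.X n ≅ A.X m := eqToIso (by rw [h])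

@[simp] lemma cast_refl (A : Orbit e) (n : ℤ) : A.cast (rfl : n = n) = Iso.refl _ := rfl

lemma cast_comp (A : Orbit e) {n m k : ℤ} (h : n = m) (h' : m = k) :
    (A.cast h).hom ≫ (A.cast h').hom = (A.cast (h.trans h')).hom := by
  subst h; subst h'; simp

lemma cast_nat {A B : Orbit e} (φ : A ⟶ B) {n m : ℤ} (h : n = m) :
    φ.f n ≫ (B.cast h).hom = (A.cast h).hom ≫ φ.f m := by
  subst h; simp

lemma cast_σ (A : Orbit e) {n n' m m' : ℤ} (h : n + 1 = n') (k : m + 1 = m') (i : n = m)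
    (j : n' = m') :
    e.functor.map (A.cast i).hom ≫ (A.σ m m' k).hom = (A.σ n n' h).hom ≫ (A.cast j).hom := by
  subst i; subst j; simp

/-- Translation of the index by `m`. -/
@[simps]
def translate (e : C ≌ C) (m : ℤ) : Orbit e ⥤ Orbit e where
  obj A :=
    { X := fun n => A.X (m + n)
      σ := fun _ _ _ => A.σ _ _ (by omega) }
  map φ :=
    { f := fun n => φ.f (m + n)
      comm := fun _ _ _ => φ.comm _ _ _ }

/-- Translation by `0` is isomorphic to the identity. -/
def translateZero (e : C ≌ C) : translate e 0 ≅ 𝟭 _ :=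
  NatIso.ofComponents
    (fun A =>
      { hom := { f := fun n => (A.cast (zero_add n)).hom
                 comm := fun _ _ _ => A.cast_σ _ _ _ _ }
        inv := { f := fun n => (A.cast (zero_add n).symm).hom
                 comm := fun _ _ _ => A.cast_σ _ _ _ _ }
        hom_inv_id := hom_ext _ _ fun n => A.cast_comp (zero_add n) (zero_add n).symm
        inv_hom_id := hom_ext _ _ fun n => A.cast_comp (zero_add n).symm (zero_add n) })
    (fun φ => hom_ext _ _ fun n => cast_nat φ (zero_add n))

/-- Translation by a sum is isomorphic to the composite of the translations. -/
def translateAdd (e : C ≌ C) (a b : ℤ) : translate e (a + b) ≅ translate e a ⋙ translate e b :=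
  NatIso.ofComponents
    (fun A =>
      { hom := { f := fun n => (A.cast (add_assoc a b n)).hom
                 comm := fun _ _ _ => A.cast_σ _ _ _ _ }
        inv := { f := fun n => (A.cast (add_assoc a b n).symm).hom
                 comm := fun _ _ _ => A.cast_σ _ _ _ _ }
        hom_inv_id := hom_ext _ _ fun n => A.cast_comp (add_assoc a b n) (add_assoc a b n).symm
        inv_hom_id := hom_ext _ _ fun n => A.cast_comp (add_assoc a b n).symm (add_assoc a b n) })
    (fun φ => hom_ext _ _ fun n => cast_nat φ (add_assoc a b n))

lemma eqToHom_f {A B : Orbit e} (h : A = B) (n : ℤ) :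
    Hom.f (eqToHom h) n = eqToHom (by rw [h]) := by
  subst h; rfl

/-- The shift by `m` on orbits translates the index by `m`. -/
instance : HasShift (Orbit e) ℤ := hasShiftMk _ _
  { F := translate e
    zero := translateZero e
    add := translateAdd e
    assoc_hom_app := fun a b c A => hom_ext _ _ fun n => by
      rw [comp_f, comp_f, comp_f, eqToHom_f]
      refine (A.cast_comp (add_assoc (a + b) c n) (add_assoc a b (c + n))).trans ?_
      refine Eq.trans ?_ (congrArg (eqToHom _ ≫ ·)
        (A.cast_comp (add_assoc a (b + c) n) (congrArg (a + ·) (add_assoc b c n))).symm)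
      exact (eqToHom_trans _ (congrArg A.X (by omega :
        a + (b + c) + n = a + (b + (c + n))))).symm
    zero_add_hom_app := fun a A => hom_ext _ _ fun n => by
      rw [comp_f, eqToHom_f]
      exact (eqToHom_trans _ (congrArg A.X (by omega : a + n = 0 + (a + n)))).symm
    add_zero_hom_app := fun a A => hom_ext _ _ fun n => by
      rw [comp_f, eqToHom_f]
      exact (eqToHom_trans _ (congrArg A.X (by omega : a + n = a + (0 + n)))).symm }

/-- Evaluation at the index `0`. -/
def ev (e : C ≌ C) : Orbit e ⥤ C where
  obj A := A.X 0
  map φ := φ.f 0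

/-- Extension of a morphism at the index `0` to nonnegative indices. -/
def extendUp {A B : Orbit e} (g : A.X 0 ⟶ B.X 0) : ∀ n : ℕ, A.X (Int.ofNat n) ⟶ B.X (Int.ofNat n)
  | 0 => g
  | n + 1 => (A.σ (Int.ofNat n) (Int.ofNat (n + 1)) rfl).inv ≫
        e.functor.map (extendUp g n) ≫ (B.σ (Int.ofNat n) (Int.ofNat (n + 1)) rfl).hom

/-- Extension of a morphism at the index `0` to negative indices. -/
noncomputable def extendDown {A B : Orbit e} (g : A.X 0 ⟶ B.X 0) :
    ∀ n : ℕ, A.X (Int.negSucc n) ⟶ B.X (Int.negSucc n)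
  | 0 => e.functor.preimage
      ((A.σ (Int.negSucc 0) 0 rfl).hom ≫ g ≫ (B.σ (Int.negSucc 0) 0 rfl).inv)
  | n + 1 =>
      e.functor.preimage ((A.σ (Int.negSucc (n + 1)) (Int.negSucc n) rfl).hom ≫
        extendDown g n ≫ (B.σ (Int.negSucc (n + 1)) (Int.negSucc n) rfl).inv)

/-- Extension of a morphism at the index `0` to all indices. -/
noncomputable def extend {A B : Orbit e} (g : A.X 0 ⟶ B.X 0) : ∀ n : ℤ, A.X n ⟶ B.X n
  | Int.ofNat n => extendUp g n
  | Int.negSucc n => extendDown g n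

lemma extend_comm {A B : Orbit e} (g : A.X 0 ⟶ B.X 0) (n n' : ℤ) (h : n + 1 = n') :
    e.functor.map (extend g n) ≫ (B.σ n n' h).hom = (A.σ n n' h).hom ≫ extend g n' := by
  subst h
  match n with
  | Int.ofNat n =>
    exact (Iso.hom_inv_id_assoc (A.σ (Int.ofNat n) (Int.ofNat (n + 1)) rfl) _).symm
  | Int.negSucc 0 =>
    change e.functor.map (e.functor.preimage ((A.σ (Int.negSucc 0) 0 rfl).hom ≫ g ≫
      (B.σ (Int.negSucc 0) 0 rfl).inv)) ≫ (B.σ (Int.negSucc 0) 0 rfl).hom =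
      (A.σ (Int.negSucc 0) 0 rfl).hom ≫ g
    simp
  | Int.negSucc (n + 1) =>
    change e.functor.map (e.functor.preimage ((A.σ (Int.negSucc (n + 1)) (Int.negSucc n) rfl).hom ≫
      extendDown g n ≫ (B.σ (Int.negSucc (n + 1)) (Int.negSucc n) rfl).inv)) ≫
      (B.σ (Int.negSucc (n + 1)) (Int.negSucc n) rfl).hom =
      (A.σ (Int.negSucc (n + 1)) (Int.negSucc n) rfl).hom ≫ extendDown g n
    simp

lemma ev_injective {A B : Orbit e} (φ ψ : A ⟶ B) (h : φ.f 0 = ψ.f 0) : φ = ψ := by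
  have up : ∀ n n' : ℤ, n + 1 = n' → (φ.f n = ψ.f n ↔ φ.f n' = ψ.f n') := by
    intro n n' hn
    have h₁ := φ.comm n n' hn
    have h₂ := ψ.comm n n' hn
    constructor
    · intro h
      rw [h, h₂] at h₁
      exact ((cancel_epi _).1 h₁).symm
    · intro h
      rw [h, ← h₂] at h₁
      exact e.functor.map_injective ((cancel_mono _).1 h₁)
  refine hom_ext _ _ fun n => ?_
  induction n using Int.induction_on with
  | zero => exact h
  | succ n hn => exact (up _ _ rfl).1 hn
  | pred n hn => exact (up _ _ (by omega)).2 hn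

/-- A morphism of orbits is determined by its value at `0`, which is arbitrary. -/
noncomputable def evFullyFaithful (e : C ≌ C) : (ev e).FullyFaithful where
  preimage g := { f := extend g, comm := extend_comm g }
  map_preimage _ := rfl
  preimage_map φ := ev_injective _ φ (by rfl)

/-- The nonnegative part of the orbit of an object. -/
def objUp (e : C ≌ C) (c : C) : ℕ → C
  | 0 => c
  | n + 1 => e.functor.obj (objUp e c n)

/-- The negative part of the orbit of an object. -/
def objDown (e : C ≌ C) (c : C) : ℕ → C
  | 0 => e.inverse.obj c
  | n + 1 => e.inverse.obj (objDown e c n)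

/-- The orbit of an object, on objects. -/
def ofObj (e : C ≌ C) (c : C) : ℤ → C
  | Int.ofNat n => objUp e c n
  | Int.negSucc n => objDown e c n

/-- The identifications in the orbit of an object. -/
def ofObjσ (e : C ≌ C) (c : C) :
    ∀ n n' : ℤ, n + 1 = n' → (e.functor.obj (ofObj e c n) ≅ ofObj e c n')
  | Int.ofNat _, _, rfl => Iso.refl _
  | Int.negSucc 0, _, rfl => e.counitIso.app c
  | Int.negSucc (n + 1), _, rfl => e.counitIso.app (objDown e c n)

/-- The orbit of an object. -/
def orbit (e : C ≌ C) (c : C) : Orbit e where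
  X := ofObj e c
  σ := ofObjσ e c

/-- Every object gives rise to its orbit, functorially. -/
noncomputable def orbitFunctor (e : C ≌ C) : C ⥤ Orbit e where
  obj c := orbit e c
  map {c d} g := { f := extend (A := orbit e c) (B := orbit e d) g, comm := extend_comm _ }
  map_id _ := ev_injective _ _ (by rfl)
  map_comp _ _ := ev_injective _ _ (by rfl)

/-- The functor of orbits is fully faithful. -/
noncomputable def orbitFunctorFullyFaithful (e : C ≌ C) : (orbitFunctor e).FullyFaithful where
  preimage {c d} φ := (show (orbit e c).X 0 ⟶ (orbit e d).X 0 from φ.f 0)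
  map_preimage _ := ev_injective _ _ (by rfl)
  preimage_map _ := by rfl

/-- The `n`-th power of the autoequivalence `e`, with its comparison to the translation of orbits;
for `n = 1` it is `e.functor` itself. -/
noncomputable def power (e : C ≌ C) :
    ∀ n : ℤ, (s : C ⥤ C) × (s ⋙ orbitFunctor e ≅ orbitFunctor e ⋙ shiftFunctor (Orbit e) n)
  | 1 => ⟨e.functor, NatIso.ofComponents
      (fun c => (evFullyFaithful e).preimageIso
        ((orbit e c).σ 0 (1 + 0) rfl : (orbit e (e.functor.obj c)).X 0 ≅ (orbit e c).X (1 + 0)))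
      (fun g => ev_injective _ _
        (Hom.comm ((orbitFunctor e).map g) 0 (1 + 0) rfl))⟩
  | n => ⟨orbitFunctor e ⋙ shiftFunctor (Orbit e) n ⋙ ev e, NatIso.ofComponents
      (fun c => (evFullyFaithful e).preimageIso (Iso.refl ((orbit e c).X (n + 0))))
      (fun _ => ev_injective _ _ ((comp_id _).trans (id_comp _).symm))⟩

end Orbit

/-- The shift by `ℤ` given by the powers of an autoequivalence. -/
@[reducible]
noncomputable def hasShiftOfEquivalence (e : C ≌ C) : HasShift C ℤ :=
  (Orbit.orbitFunctorFullyFaithful e).hasShift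
    (fun n => (Orbit.power e n).1) (fun n => (Orbit.power e n).2)

lemma shiftFunctor_one_eq (e : C ≌ C) :
    letI := hasShiftOfEquivalence e; shiftFunctor C (1 : ℤ) = e.functor := rfl

end ShiftOfEquivalence

section Triangles

variable {K : Type u} [Category.{v} K] [HasZeroObject K] [HasShift K ℤ] [Preadditive K]
  [∀ n : ℤ, (shiftFunctor K n).Additive] [Pretriangulated K]

/-- The square with top `f : X ⟶ Y`, left `a : X ⟶ X'`, right `b : Y ⟶ Y'` and bottom
`f' : X' ⟶ Y'` is homotopy (bi)cartesian: it is a homotopy pushout of `f` and `a`, equivalently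
a homotopy pullback of `b` and `f'`. -/
def IsHomotopyCartesian {X Y X' Y' : K} (f : X ⟶ Y) (a : X ⟶ X') (b : Y ⟶ Y') (f' : X' ⟶ Y') :
    Prop :=
  ∃ d : Y' ⟶ X⟦(1 : ℤ)⟧, Triangle.mk (biprod.lift f a) (biprod.desc b (-f')) d ∈ distTriang K

/-- The direct sum of two triangles. -/
noncomputable def triangleSum (T T' : Triangle K) : Triangle K :=
  Triangle.mk (biprod.map T.mor₁ T'.mor₁) (biprod.map T.mor₂ T'.mor₂)
    (biprod.desc (T.mor₃ ≫ (biprod.inl : T.obj₁ ⟶ T.obj₁ ⊞ T'.obj₁)⟦(1 : ℤ)⟧')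
      (T'.mor₃ ≫ (biprod.inr : T'.obj₁ ⟶ T.obj₁ ⊞ T'.obj₁)⟦(1 : ℤ)⟧'))

/-- `f` occurs as the first morphism of a triangle in the class `tri`. -/
def IsMonoFor (tri : ObjectProperty (Triangle K)) {X Y : K} (f : X ⟶ Y) : Prop :=
  ∃ (Z : K) (g : Y ⟶ Z) (h : Z ⟶ X⟦(1 : ℤ)⟧), tri (Triangle.mk f g h)

/-- `g` occurs as the second morphism of a triangle in the class `tri`. -/
def IsEpiFor (tri : ObjectProperty (Triangle K)) {Y Z : K} (g : Y ⟶ Z) : Prop :=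
  ∃ (X : K) (f : X ⟶ Y) (h : Z ⟶ X⟦(1 : ℤ)⟧), tri (Triangle.mk f g h)

/-- `h` occurs as the third morphism of a triangle in the class `tri`. -/
def IsPhantomFor (tri : ObjectProperty (Triangle K)) {X Z : K} (h : Z ⟶ X⟦(1 : ℤ)⟧) : Prop :=
  ∃ (Y : K) (f : X ⟶ Y) (g : Y ⟶ Z), tri (Triangle.mk f g h)

end Triangles

/-- A proper class of triangles in a triangulated category. -/
structure ProperClass (K : Type u) [Category.{v} K] [HasZeroObject K] [HasShift K ℤ]
    [Preadditive K] [∀ n : ℤ, (shiftFunctor K n).Additive] [Pretriangulated K] where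
  /-- the triangles of the class -/
  tri : ObjectProperty (Triangle K)
  distinguished : ∀ T : Triangle K, tri T → T ∈ distTriang K
  of_iso : ∀ {T T' : Triangle K}, (T ≅ T') → tri T → tri T'
  shift : ∀ (T : Triangle K) (n : ℤ), tri T → tri ((Triangle.shiftFunctor K n).obj T)
  sum : ∀ T T' : Triangle K, tri T → tri T' → tri (triangleSum T T')
  of_retract : ∀ {T T' : Triangle K}, Retract T T' → tri T' → tri T
  /-- the triangles `X = X ⟶ 0 ⟶ X⟦1⟧` -/
  trivial_left : ∀ X : K, tri (Triangle.mk (𝟙 X) (0 : X ⟶ 0) 0)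
  /-- the triangles `0 ⟶ Y = Y ⟶ 0⟦1⟧` -/
  trivial_right : ∀ Y : K, tri (Triangle.mk (0 : 0 ⟶ Y) (𝟙 Y) 0)
  /-- homotopy pushouts preserve the monomorphisms of the class -/
  mono_pushout : ∀ {X Y X' Y' : K} (f : X ⟶ Y) (a : X ⟶ X') (b : Y ⟶ Y') (f' : X' ⟶ Y'),
    IsHomotopyCartesian f a b f' → IsMonoFor tri f → IsMonoFor tri f'
  /-- homotopy pullbacks preserve the epimorphisms of the class -/
  epi_pullback : ∀ {X Y X' Y' : K} (f : X ⟶ Y) (a : X ⟶ X') (b : Y ⟶ Y') (f' : X' ⟶ Y'),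
    IsHomotopyCartesian f a b f' → IsEpiFor tri f' → IsEpiFor tri f
  /-- saturation: a morphism `f'` whose homotopy pullback along an epimorphism `b` of the class
  is an epimorphism of the class is itself one -/
  saturated : ∀ {X Y X' Y' : K} (f : X ⟶ Y) (a : X ⟶ X') (b : Y ⟶ Y') (f' : X' ⟶ Y'),
    IsHomotopyCartesian f a b f' → IsEpiFor tri b → IsEpiFor tri f → IsEpiFor tri f'

variable {K : Type u} [Category.{v} K] [HasZeroObject K] [HasShift K ℤ] [Preadditive K]
  [∀ n : ℤ, (shiftFunctor K n).Additive] [Pretriangulated K]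

namespace ProperClass

variable (E : ProperClass K)

/-- The `E`-projective objects: `Hom(P, -)` turns the triangles of `E` into short exact
sequences. -/
def proj : ObjectProperty K := fun P =>
  ∀ T : Triangle K, E.tri T →
    Function.Injective (fun w : P ⟶ T.obj₁ => w ≫ T.mor₁) ∧
    (∀ w : P ⟶ T.obj₂, w ≫ T.mor₂ = 0 ↔ ∃ w' : P ⟶ T.obj₁, w' ≫ T.mor₁ = w) ∧
    Function.Surjective (fun w : P ⟶ T.obj₂ => w ≫ T.mor₂)

/-- The `E`-injective objects: `Hom(-, J)` turns the triangles of `E` into short exact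
sequences. -/
def inj : ObjectProperty K := fun J =>
  ∀ T : Triangle K, E.tri T →
    Function.Injective (fun w : T.obj₃ ⟶ J => T.mor₂ ≫ w) ∧
    (∀ w : T.obj₂ ⟶ J, T.mor₁ ≫ w = 0 ↔ ∃ w' : T.obj₃ ⟶ J, T.mor₂ ≫ w' = w) ∧
    Function.Surjective (fun w : T.obj₂ ⟶ J => T.mor₁ ≫ w)

end ProperClass

/-- A Frobenius class of triangles: a proper class with enough projectives and enough injectives,
for which projectives and injectives coincide. -/
structure FrobeniusClass (K : Type u) [Category.{v} K] [HasZeroObject K] [HasShift K ℤ]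
    [Preadditive K] [∀ n : ℤ, (shiftFunctor K n).Additive] [Pretriangulated K]
    extends ProperClass K where
  enough_proj : ∀ X : K, ∃ (P : K) (q : P ⟶ X), toProperClass.proj P ∧ IsEpiFor tri q
  enough_inj : ∀ X : K, ∃ (J : K) (i : X ⟶ J), toProperClass.inj J ∧ IsMonoFor tri i
  proj_eq_inj : toProperClass.proj = toProperClass.inj

section TriangleLemmas

lemma dist_of_iso {X Y Z X' Y' Z' : K} {f : X ⟶ Y} {g : Y ⟶ Z} {h : Z ⟶ X⟦(1 : ℤ)⟧}
    (H : Triangle.mk f g h ∈ distTriang K) {f' : X' ⟶ Y'} {g' : Y' ⟶ Z'} {h' : Z' ⟶ X'⟦(1 : ℤ)⟧}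
    (e₁ : X' ≅ X) (e₂ : Y' ≅ Y) (e₃ : Z' ≅ Z) (h₁ : f' ≫ e₂.hom = e₁.hom ≫ f)
    (h₂ : g' ≫ e₃.hom = e₂.hom ≫ g) (h₃ : h' ≫ e₁.hom⟦1⟧' = e₃.hom ≫ h) :
    Triangle.mk f' g' h' ∈ distTriang K :=
  isomorphic_distinguished _ H _ (Triangle.isoMk _ _ e₁ e₂ e₃ h₁ h₂ h₃)

/-- The negative of an isomorphism. -/
@[simps]
def negIso {X Y : K} (e : X ≅ Y) : X ≅ Y where
  hom := -e.hom
  inv := -e.inv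

lemma dist_neg₁₂ {X Y Z : K} {f : X ⟶ Y} {g : Y ⟶ Z} {h : Z ⟶ X⟦(1 : ℤ)⟧}
    (H : Triangle.mk f g h ∈ distTriang K) : Triangle.mk (-f) (-g) h ∈ distTriang K :=
  dist_of_iso H (Iso.refl _) (negIso (Iso.refl _)) (Iso.refl _) (by simp) (by simp) (by simp)

lemma dist_neg₁₃ {X Y Z : K} {f : X ⟶ Y} {g : Y ⟶ Z} {h : Z ⟶ X⟦(1 : ℤ)⟧}
    (H : Triangle.mk f g h ∈ distTriang K) : Triangle.mk (-f) g (-h) ∈ distTriang K :=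
  dist_of_iso H (negIso (Iso.refl _)) (Iso.refl _) (Iso.refl _) (by simp) (by simp) (by simp)

lemma dist_neg₂₃ {X Y Z : K} {f : X ⟶ Y} {g : Y ⟶ Z} {h : Z ⟶ X⟦(1 : ℤ)⟧}
    (H : Triangle.mk f g h ∈ distTriang K) : Triangle.mk f (-g) (-h) ∈ distTriang K :=
  dist_of_iso H (Iso.refl _) (Iso.refl _) (negIso (Iso.refl _)) (by simp) (by simp) (by simp)

lemma dist_rot {X Y Z : K} {f : X ⟶ Y} {g : Y ⟶ Z} {h : Z ⟶ X⟦(1 : ℤ)⟧} :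
    Triangle.mk f g h ∈ distTriang K ↔ Triangle.mk g h (-f⟦(1 : ℤ)⟧') ∈ distTriang K :=
  rotate_distinguished_triangle (Triangle.mk f g h)

/-- Homotopy pullback of the second morphism of a distinguished triangle. -/
lemma exists_homotopy_pullback [IsTriangulated K] {X Y Z Z' : K} {f : X ⟶ Y} {g : Y ⟶ Z}
    {h : Z ⟶ X⟦(1 : ℤ)⟧} (H : Triangle.mk f g h ∈ distTriang K) (a : Z' ⟶ Z) :
    ∃ (W : K) (f' : X ⟶ W) (g' : W ⟶ Z') (b : W ⟶ Y),
      Triangle.mk f' g' (a ≫ h) ∈ distTriang K ∧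
      Triangle.mk (biprod.lift g' b) (biprod.desc a (-g)) (-(h ≫ f'⟦(1 : ℤ)⟧')) ∈ distTriang K ∧
      f' ≫ b = f := by
  obtain ⟨W, l, d, hW⟩ := distinguished_cocone_triangle₁ (biprod.desc a (-g))
  have h₁ : Triangle.mk (biprod.inr : Y ⟶ Z' ⊞ Y) (biprod.fst : Z' ⊞ Y ⟶ Z') 0 ∈ distTriang K :=
    dist_of_iso (binaryBiproductTriangle_distinguished Y Z') (Iso.refl _) (biprod.braiding _ _)
      (Iso.refl _) (by ext <;> simp) (by simp) (by simp)
  have h₂ := dist_rot.1 hW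
  have h₃ : Triangle.mk (-g) h (f⟦(1 : ℤ)⟧') ∈ distTriang K := by
    simpa using dist_neg₁₃ (dist_rot.1 H)
  let o := Triangulated.someOctahedron (biprod.inr_desc a (-g)) h₁ h₂ h₃
  have c₁ := o.comm₁
  have c₃ := o.comm₃
  have c₄ := o.comm₄
  have m := o.mem
  have e₁ : o.m₁ = a ≫ h := by
    have := congrArg (biprod.inl ≫ ·) c₁
    simpa using this
  obtain ⟨f'', hf''⟩ := (shiftFunctor K (1 : ℤ)).map_surjective o.m₃
  have e₃ : h ≫ f''⟦(1 : ℤ)⟧' = d := by rw [hf'', c₃]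
  have hl : l = biprod.lift (l ≫ biprod.fst) (l ≫ biprod.snd) := by ext <;> simp
  refine ⟨W, -f'', l ≫ biprod.fst, l ≫ biprod.snd, ?_, ?_, ?_⟩
  · rw [dist_rot, dist_rot]
    rw [e₁, ← hf''] at m
    simpa using m
  · rw [← hl]
    simpa [e₃] using hW
  · apply (shiftFunctor K (1 : ℤ)).map_injective
    rw [← hf''] at c₄
    have := congrArg (· ≫ (biprod.snd : Z' ⊞ Y ⟶ Y)⟦(1 : ℤ)⟧') c₄
    simp only [assoc, ← Functor.map_comp, Preadditive.comp_neg, Preadditive.neg_comp] at this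
    simp only [biprod.inr_snd, comp_id] at this
    rw [this, Preadditive.neg_comp, Functor.map_neg]

/-- Homotopy pushout of the first morphism of a distinguished triangle. -/
lemma exists_homotopy_pushout [IsTriangulated K] {X I S Y : K} {i : X ⟶ I} {p : I ⟶ S}
    {d : S ⟶ X⟦(1 : ℤ)⟧} (H : Triangle.mk i p d ∈ distTriang K) (f : X ⟶ Y) :
    ∃ (Z : K) (z : I ⟶ Z) (g : Y ⟶ Z) (h : Z ⟶ S),
      IsHomotopyCartesian i f z g ∧ z ≫ h = p ∧
      Triangle.mk g h (d ≫ f⟦(1 : ℤ)⟧') ∈ distTriang K := by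
  obtain ⟨Z, r, s, hZ⟩ := distinguished_cocone_triangle (biprod.lift i f)
  have h₁ : Triangle.mk (biprod.inr : Y ⟶ I ⊞ Y) (biprod.fst : I ⊞ Y ⟶ I) 0 ∈ distTriang K :=
    dist_of_iso (binaryBiproductTriangle_distinguished Y I) (Iso.refl _) (biprod.braiding _ _)
      (Iso.refl _) (by ext <;> simp) (by simp) (by simp)
  have h₂ := dist_rot.1 h₁
  let o := Triangulated.someOctahedron (biprod.lift_fst i f) hZ h₂ H
  have c₁ := o.comm₁
  have c₂ := o.comm₂
  have c₄ := o.comm₄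
  have m := o.mem
  have e : o.m₃ = -(d ≫ f⟦(1 : ℤ)⟧') := by
    have := congrArg (· ≫ (biprod.snd : I ⊞ Y ⟶ Y)⟦(1 : ℤ)⟧') c₄
    simp only [assoc, ← Functor.map_comp, Preadditive.comp_neg, Preadditive.neg_comp] at this
    simp only [biprod.inr_snd, biprod.lift_snd, CategoryTheory.Functor.map_id, comp_id] at this
    rw [this, neg_neg]
  have hr : r = biprod.desc (biprod.inl ≫ r) (-(-(biprod.inr ≫ r))) := by ext <;> simp
  refine ⟨Z, biprod.inl ≫ r, -(biprod.inr ≫ r), o.m₁, ⟨s, by rw [← hr]; exact hZ⟩, ?_, ?_⟩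
  · have := congrArg (biprod.inl ≫ ·) c₁
    simpa using this
  · rw [dist_rot]
    rw [e] at m
    have := dist_neg₂₃ m
    simpa using this

end TriangleLemmas

namespace ProperClass

variable (E : ProperClass K)

lemma tri_of_isMono {X Y Z : K} {f : X ⟶ Y} {g : Y ⟶ Z} {h : Z ⟶ X⟦(1 : ℤ)⟧}
    (H : Triangle.mk f g h ∈ distTriang K) (hf : IsMonoFor E.tri f) :
    E.tri (Triangle.mk f g h) := by
  obtain ⟨Z', g', h', H'⟩ := hf
  exact E.of_iso (isoTriangleOfIso₁₂ _ _ (E.distinguished _ H') H (Iso.refl _) (Iso.refl _)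
    ((comp_id _).trans (id_comp _).symm)) H'

lemma tri_of_isEpi {X Y Z : K} {f : X ⟶ Y} {g : Y ⟶ Z} {h : Z ⟶ X⟦(1 : ℤ)⟧}
    (H : Triangle.mk f g h ∈ distTriang K) (hg : IsEpiFor E.tri g) :
    E.tri (Triangle.mk f g h) := by
  obtain ⟨X', f', h', H'⟩ := hg
  obtain ⟨a, ha₁, ha₂⟩ := complete_distinguished_triangle_morphism₁ _ _ (E.distinguished _ H') H
    (𝟙 _) (𝟙 _) ((comp_id _).trans (id_comp _).symm)
  let φ : Triangle.mk f' g h' ⟶ Triangle.mk f g h :=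
    { hom₁ := a, hom₂ := 𝟙 _, hom₃ := 𝟙 _, comm₁ := ha₁
      comm₂ := (comp_id _).trans (id_comp _).symm, comm₃ := ha₂ }
  have : IsIso φ.hom₁ := isIso₁_of_isIso₂₃ φ (E.distinguished _ H') H
    (inferInstanceAs (IsIso (𝟙 _))) (inferInstanceAs (IsIso (𝟙 _)))
  exact E.of_iso (Triangle.isoMk _ _ (asIso φ.hom₁) (Iso.refl _) (Iso.refl _)
    φ.comm₁ φ.comm₂ φ.comm₃) H'

lemma tri_of_isPhantom {X Y Z : K} {f : X ⟶ Y} {g : Y ⟶ Z} {h : Z ⟶ X⟦(1 : ℤ)⟧}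
    (H : Triangle.mk f g h ∈ distTriang K) (hh : IsPhantomFor E.tri h) :
    E.tri (Triangle.mk f g h) := by
  obtain ⟨Y', f', g', H'⟩ := hh
  exact E.of_iso (isoTriangleOfIso₁₃ _ _ (E.distinguished _ H') H (Iso.refl _) (Iso.refl _)
    (by
      change h ≫ (𝟙 X)⟦(1 : ℤ)⟧' = 𝟙 _ ≫ h
      simp)) H'

lemma proj_lift {P X Y Z : K} (hP : E.proj P) {f : X ⟶ Y} {g : Y ⟶ Z} {h : Z ⟶ X⟦(1 : ℤ)⟧}
    (H : E.tri (Triangle.mk f g h)) (w : P ⟶ Z) : ∃ w' : P ⟶ Y, w' ≫ g = w :=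
  (hP _ H).2.2 w

lemma inj_extend {J X Y Z : K} (hJ : E.inj J) {f : X ⟶ Y} {g : Y ⟶ Z} {h : Z ⟶ X⟦(1 : ℤ)⟧}
    (H : E.tri (Triangle.mk f g h)) (w : X ⟶ J) : ∃ w' : Y ⟶ J, f ≫ w' = w :=
  (hJ _ H).2.2 w

lemma comp_phantom_of_proj {P X Z : K} (hP : E.proj P) {h : Z ⟶ X⟦(1 : ℤ)⟧}
    (hh : IsPhantomFor E.tri h) (w : P ⟶ Z) : w ≫ h = 0 := by
  obtain ⟨Y, f, g, H⟩ := hh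
  obtain ⟨w', rfl⟩ := E.proj_lift hP H w
  have : g ≫ h = 0 := comp_distTriang_mor_zero₂₃ _ (E.distinguished _ H)
  rw [assoc, this, comp_zero]

lemma phantom_comp_of_inj {J X Z : K} (hJ : E.inj J) {h : Z ⟶ X⟦(1 : ℤ)⟧}
    (hh : IsPhantomFor E.tri h) (w : X ⟶ J) : h ≫ w⟦(1 : ℤ)⟧' = 0 := by
  obtain ⟨Y, f, g, H⟩ := hh
  obtain ⟨w', rfl⟩ := E.inj_extend hJ H w
  have : h ≫ f⟦(1 : ℤ)⟧' = 0 := comp_distTriang_mor_zero₃₁ _ (E.distinguished _ H)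
  rw [Functor.map_comp, reassoc_of% this, zero_comp]

variable [IsTriangulated K]

lemma isPhantom_precomp {X Z Z' : K} {h : Z ⟶ X⟦(1 : ℤ)⟧} (hh : IsPhantomFor E.tri h)
    (a : Z' ⟶ Z) : IsPhantomFor E.tri (a ≫ h) := by
  obtain ⟨Y, f, g, H⟩ := hh
  obtain ⟨W, f', g', b, H₁, H₂, -⟩ := exists_homotopy_pullback (E.distinguished _ H) a
  exact ⟨W, f', g', E.tri_of_isEpi H₁
    (E.epi_pullback g' b a g ⟨_, H₂⟩ ⟨_, _, _, H⟩)⟩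

end ProperClass

namespace FrobeniusClass

variable (E : FrobeniusClass K)

lemma inj_of_proj {P : K} (hP : E.proj P) : E.inj P := E.proj_eq_inj ▸ hP

lemma proj_of_inj {P : K} (hP : E.inj P) : E.proj P := E.proj_eq_inj ▸ hP

lemma exists_preenvelope (X : K) :
    ∃ (J S : K) (i : X ⟶ J) (p : J ⟶ S) (d : S ⟶ X⟦(1 : ℤ)⟧),
      E.inj J ∧ E.tri (Triangle.mk i p d) := by
  obtain ⟨J, i, hJ, S, p, d, H⟩ := E.enough_inj X
  exact ⟨J, S, i, p, d, hJ, H⟩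

/-- The target of a chosen injective preenvelope of `X`. -/
noncomputable def env (X : K) : K := (E.exists_preenvelope X).choose

/-- The cofibre of the chosen injective preenvelope of `X`. -/
noncomputable def cosyz (X : K) : K := (E.exists_preenvelope X).choose_spec.choose

/-- The chosen injective preenvelope of `X`. -/
noncomputable def ι (X : K) : X ⟶ E.env X := (E.exists_preenvelope X).choose_spec.choose_spec.choose

/-- The second morphism of the chosen triangle on the preenvelope of `X`. -/
noncomputable def p (X : K) : E.env X ⟶ E.cosyz X :=
  (E.exists_preenvelope X).choose_spec.choose_spec.choose_spec.choose

/-- The third morphism of the chosen triangle on the preenvelope of `X`. -/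
noncomputable def δ (X : K) : E.cosyz X ⟶ X⟦(1 : ℤ)⟧ :=
  (E.exists_preenvelope X).choose_spec.choose_spec.choose_spec.choose_spec.choose

lemma inj_env (X : K) : E.inj (E.env X) :=
  (E.exists_preenvelope X).choose_spec.choose_spec.choose_spec.choose_spec.choose_spec.1

lemma tri_env (X : K) : E.tri (Triangle.mk (E.ι X) (E.p X) (E.δ X)) :=
  (E.exists_preenvelope X).choose_spec.choose_spec.choose_spec.choose_spec.choose_spec.2

lemma dist_env (X : K) : Triangle.mk (E.ι X) (E.p X) (E.δ X) ∈ distTriang K :=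
  E.distinguished _ (E.tri_env X)

lemma phantom_δ (X : K) : IsPhantomFor E.tri (E.δ X) := ⟨_, _, _, E.tri_env X⟩

/-- `f` and `g` differ by a morphism that factors through a projective-injective object. -/
def relation : HomRel K := fun X Y f g =>
  ∃ (J : K) (a : X ⟶ J) (b : J ⟶ Y), E.proj J ∧ f - g = a ≫ b

lemma relation_iff {X Y : K} (f g : X ⟶ Y) :
    E.relation f g ↔ E.δ X ≫ f⟦(1 : ℤ)⟧' = E.δ X ≫ g⟦(1 : ℤ)⟧' := by
  rw [← sub_eq_zero, ← Preadditive.comp_sub, ← Functor.map_sub]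
  constructor
  · rintro ⟨J, a, b, hJ, h⟩
    rw [h, Functor.map_comp, ← assoc, E.phantom_comp_of_inj (E.inj_of_proj hJ) (E.phantom_δ X),
      zero_comp]
  · intro h
    obtain ⟨w, hw⟩ := Triangle.yoneda_exact₃ _ (rot_of_distTriang _ (E.dist_env X)) _ h
    obtain ⟨(b : E.env X ⟶ Y), rfl⟩ := (shiftFunctor K (1 : ℤ)).map_surjective w
    refine ⟨E.env X, -E.ι X, b, E.proj_of_inj (E.inj_env X), ?_⟩
    apply (shiftFunctor K (1 : ℤ)).map_injective
    rw [Functor.map_comp, Functor.map_neg]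
    exact hw

instance : Congruence E.relation where
  equivalence :=
    { refl := fun f => (E.relation_iff f f).2 rfl
      symm := fun {f g} h => (E.relation_iff g f).2 ((E.relation_iff f g).1 h).symm
      trans := fun {f g k} h h' => (E.relation_iff f k).2
        (((E.relation_iff f g).1 h).trans ((E.relation_iff g k).1 h')) }
  comp_left := by
    rintro X Y Z f g g' ⟨J, a, b, hJ, h⟩
    exact ⟨J, f ≫ a, b, hJ, by rw [← Preadditive.comp_sub, h, assoc]⟩
  comp_right := by
    rintro X Y Z f f' g ⟨J, a, b, hJ, h⟩
    exact ⟨J, a, b ≫ g, hJ, by rw [← Preadditive.sub_comp, h, assoc]⟩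

lemma relation_add ⦃X Y : K⦄ (f₁ f₂ g₁ g₂ : X ⟶ Y) (h : E.relation f₁ f₂)
    (h' : E.relation g₁ g₂) : E.relation (f₁ + g₁) (f₂ + g₂) := by
  rw [relation_iff] at h h' ⊢
  rw [Functor.map_add, Functor.map_add, Preadditive.comp_add, Preadditive.comp_add, h, h']

/-- The relative stable category of `K` with respect to `E`: the quotient of `K` by the ideal of
the morphisms that factor through a projective-injective object. -/
def Stable : Type u := Quotient E.relation

instance : Category.{v} E.Stable := inferInstanceAs (Category (Quotient E.relation))

instance : Preadditive E.Stable := Quotient.preadditive E.relation E.relation_add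

/-- The quotient functor; it is the identity on objects. -/
def π : K ⥤ E.Stable := Quotient.functor E.relation

instance : E.π.Additive := Quotient.functor_additive E.relation E.relation_add

instance : E.π.Full := inferInstanceAs (Quotient.functor E.relation).Full

instance : E.π.EssSurj := inferInstanceAs (Quotient.functor E.relation).EssSurj

lemma π_map_eq_iff_relation {X Y : K} (f g : X ⟶ Y) :
    E.π.map f = E.π.map g ↔ E.relation f g :=
  Quotient.functor_map_eq_iff E.relation f g

lemma π_map_eq_iff {X Y : K} (f g : X ⟶ Y) :
    E.π.map f = E.π.map g ↔ E.δ X ≫ f⟦(1 : ℤ)⟧' = E.δ X ≫ g⟦(1 : ℤ)⟧' :=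
  (E.π_map_eq_iff_relation f g).trans (E.relation_iff f g)

lemma π_map_eq_zero_of_factor {X Y J : K} (hJ : E.proj J) (a : X ⟶ J) (b : J ⟶ Y) :
    E.π.map (a ≫ b) = 0 := by
  rw [← E.π.map_zero, π_map_eq_iff_relation]
  exact ⟨J, a, b, hJ, sub_zero _⟩

/-- Morphisms into a cosyzygy are equal in the stable category as soon as they have the same
composite with the connecting morphism. -/
lemma π_map_eq_iff_comp_δ {X Y : K} (s t : X ⟶ E.cosyz Y) :
    E.π.map s = E.π.map t ↔ s ≫ E.δ Y = t ≫ E.δ Y := by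
  rw [π_map_eq_iff_relation]
  constructor
  · rintro ⟨J, a, b, hJ, h⟩
    rw [← sub_eq_zero, ← Preadditive.sub_comp, h, assoc,
      E.comp_phantom_of_proj hJ (E.phantom_δ Y), comp_zero]
  · intro h
    obtain ⟨w, hw⟩ := Triangle.coyoneda_exact₃ _ (E.dist_env Y) (s - t)
      (show (s - t) ≫ E.δ Y = 0 by rw [Preadditive.sub_comp, h, sub_self])
    exact ⟨_, w, E.p Y, E.proj_of_inj (E.inj_env Y), hw⟩

/-- The phantoms lift along the connecting morphisms. -/
lemma exists_lift_δ {X Z : K} {h : Z ⟶ X⟦(1 : ℤ)⟧} (hh : IsPhantomFor E.tri h) :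
    ∃ s : Z ⟶ E.cosyz X, s ≫ E.δ X = h := by
  obtain ⟨s, hs⟩ := Triangle.coyoneda_exact₁ _ (E.dist_env X) h
    (E.phantom_comp_of_inj (E.inj_env X) hh (E.ι X))
  exact ⟨s, hs.symm⟩

lemma exists_susp {X Y : K} (f : X ⟶ Y) :
    ∃ s : E.cosyz X ⟶ E.cosyz Y, s ≫ E.δ Y = E.δ X ≫ f⟦(1 : ℤ)⟧' := by
  obtain ⟨s, hs⟩ := Triangle.coyoneda_exact₁ _ (E.dist_env Y) (E.δ X ≫ f⟦(1 : ℤ)⟧') (by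
    change (E.δ X ≫ f⟦(1 : ℤ)⟧') ≫ (E.ι Y)⟦(1 : ℤ)⟧' = 0
    rw [assoc, ← Functor.map_comp]
    exact E.phantom_comp_of_inj (E.inj_env Y) (E.phantom_δ X) _)
  exact ⟨s, hs.symm⟩

lemma exists_susp' {A B : E.Stable} (φ : A ⟶ B) :
    ∃ (s : E.cosyz A.as ⟶ E.cosyz B.as) (f : A.as ⟶ B.as), E.π.map f = φ ∧
      s ≫ E.δ B.as = E.δ A.as ≫ f⟦(1 : ℤ)⟧' := by
  obtain ⟨f, hf⟩ := E.π.map_surjective (X := A.as) (Y := B.as) φ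
  obtain ⟨s, hs⟩ := E.exists_susp f
  exact ⟨s, f, hf, hs⟩

/-- The suspension of a morphism of the stable category: it is represented by the morphism induced
between the cofibres of the preenvelopes. -/
noncomputable def suspMap {A B : E.Stable} (φ : A ⟶ B) :
    E.π.obj (E.cosyz A.as) ⟶ E.π.obj (E.cosyz B.as) :=
  E.π.map (E.exists_susp' φ).choose

lemma suspMap_eq {X Y : K} (f : X ⟶ Y) (s : E.cosyz X ⟶ E.cosyz Y)
    (hs : s ≫ E.δ Y = E.δ X ≫ f⟦(1 : ℤ)⟧') : E.suspMap (E.π.map f) = E.π.map s := by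
  obtain ⟨f', hf', hs'⟩ := (E.exists_susp' (E.π.map f)).choose_spec
  refine (E.π_map_eq_iff_comp_δ _ _).2 (hs'.trans (Eq.trans ?_ hs.symm))
  exact (E.π_map_eq_iff f' f).1 hf'

/-- The suspension functor of the relative stable category: it sends `X` to the cofibre of an
injective preenvelope of `X`. -/
noncomputable def susp : E.Stable ⥤ E.Stable where
  obj A := E.π.obj (E.cosyz A.as)
  map φ := E.suspMap φ
  map_id A := by
    refine (E.suspMap_eq (𝟙 A.as) (𝟙 _) ?_).trans (E.π.map_id _)
    rw [CategoryTheory.Functor.map_id, id_comp, comp_id]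
  map_comp {A B C} φ ψ := by
    obtain ⟨f, rfl⟩ := E.π.map_surjective (X := A.as) (Y := B.as) φ
    obtain ⟨g, rfl⟩ := E.π.map_surjective (X := B.as) (Y := C.as) ψ
    obtain ⟨s, hs⟩ := E.exists_susp f
    obtain ⟨t, ht⟩ := E.exists_susp g
    refine Eq.trans ?_ (congrArg₂ (· ≫ ·) (E.suspMap_eq f s hs).symm (E.suspMap_eq g t ht).symm)
    refine Eq.trans ?_ (E.π.map_comp s t)
    refine Eq.trans (congrArg E.suspMap (E.π.map_comp f g).symm) (E.suspMap_eq _ _ ?_)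
    rw [assoc, ht, ← assoc, hs, assoc, Functor.map_comp]

lemma susp_map_eq {X Y : K} (f : X ⟶ Y) (s : E.cosyz X ⟶ E.cosyz Y)
    (hs : s ≫ E.δ Y = E.δ X ≫ f⟦(1 : ℤ)⟧') : E.susp.map (E.π.map f) = E.π.map s :=
  E.suspMap_eq f s hs

instance : E.susp.Faithful where
  map_injective {A B} φ ψ h := by
    obtain ⟨f, rfl⟩ := E.π.map_surjective (X := A.as) (Y := B.as) φ
    obtain ⟨g, rfl⟩ := E.π.map_surjective (X := A.as) (Y := B.as) ψ
    obtain ⟨s, hs⟩ := E.exists_susp f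
    obtain ⟨t, ht⟩ := E.exists_susp g
    have h' : E.π.map s = E.π.map t :=
      (E.susp_map_eq f s hs).symm.trans (h.trans (E.susp_map_eq g t ht))
    rw [π_map_eq_iff_comp_δ, hs, ht] at h'
    exact (E.π_map_eq_iff f g).2 h'

lemma p_comp_δ (X : K) : E.p X ≫ E.δ X = 0 := comp_distTriang_mor_zero₂₃ _ (E.dist_env X)

instance : E.susp.Full where
  map_surjective {A B} φ := by
    obtain ⟨s, rfl⟩ := E.π.map_surjective (X := E.cosyz A.as) (Y := E.cosyz B.as) φ
    have h : E.p A.as ≫ s ≫ E.δ B.as = 0 := by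
      rw [← assoc]
      exact E.comp_phantom_of_proj (E.proj_of_inj (E.inj_env _)) (E.phantom_δ _) _
    obtain ⟨w, hw⟩ := Triangle.yoneda_exact₃ _ (E.dist_env A.as) (s ≫ E.δ B.as) h
    obtain ⟨f, rfl⟩ := (shiftFunctor K (1 : ℤ)).map_surjective w
    exact ⟨E.π.map f, E.susp_map_eq f s hw⟩

/-- The cofibre of any morphism of `E` with projective-injective target is a suspension. -/
lemma exists_iso_cosyz {X J Z : K} {i : X ⟶ J} {q : J ⟶ Z} {d : Z ⟶ X⟦(1 : ℤ)⟧}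
    (H : E.tri (Triangle.mk i q d)) (hJ : E.proj J) :
    Nonempty (E.π.obj (E.cosyz X) ≅ E.π.obj Z) := by
  obtain ⟨s, hs⟩ := E.exists_lift_δ ⟨_, _, _, H⟩
  have hq : q ≫ d = 0 := comp_distTriang_mor_zero₂₃ _ (E.distinguished _ H)
  obtain ⟨t, ht⟩ : ∃ t : E.cosyz X ⟶ Z, E.δ X = t ≫ d :=
    Triangle.coyoneda_exact₁ _ (E.distinguished _ H) (E.δ X)
      (E.phantom_comp_of_inj (E.inj_of_proj hJ) (E.phantom_δ X) i)
  refine ⟨⟨E.π.map t, E.π.map s, ?_, ?_⟩⟩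
  · rw [← E.π.map_comp, ← E.π.map_id, π_map_eq_iff_comp_δ, assoc, hs, ← ht, id_comp]
  · rw [← E.π.map_comp, ← E.π.map_id, π_map_eq_iff_relation]
    obtain ⟨w, hw⟩ := Triangle.coyoneda_exact₃ _ (E.distinguished _ H) (s ≫ t - 𝟙 Z)
      (show (s ≫ t - 𝟙 Z) ≫ d = 0 by
        rw [Preadditive.sub_comp, assoc, ← ht, hs, id_comp, sub_self])
    exact ⟨J, w, q, hJ, hw⟩

instance : E.susp.EssSurj where
  mem_essImage A := by
    obtain ⟨P, q, hP, X, f, h, H⟩ := E.enough_proj A.as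
    exact ⟨E.π.obj X, E.exists_iso_cosyz H hP⟩

instance : E.susp.IsEquivalence where

/-- The shift of the relative stable category, by the powers of its suspension. -/
noncomputable instance : HasShift E.Stable ℤ := hasShiftOfEquivalence E.susp.asEquivalence

lemma shiftFunctor_one : shiftFunctor E.Stable (1 : ℤ) = E.susp := rfl

lemma isZero_of_proj {J : K} (hJ : E.proj J) : IsZero (E.π.obj J) := by
  rw [IsZero.iff_id_eq_zero, ← E.π.map_id, ← comp_id (𝟙 J)]
  exact E.π_map_eq_zero_of_factor hJ _ _

instance : HasZeroObject E.Stable :=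
  ⟨E.π.obj 0, by
    rw [IsZero.iff_id_eq_zero, ← E.π.map_id, (isZero_zero K).eq_of_src (𝟙 0) 0, E.π.map_zero]⟩

instance : HasFiniteProducts E.Stable := E.π.hasFiniteProducts_of_additive_of_essSurj

instance (n : ℤ) : (shiftFunctor E.Stable n).Additive :=
  Functor.additive_of_preserves_binary_products _

lemma shift_map_eq {X Y : K} (f : X ⟶ Y) (s : E.cosyz X ⟶ E.cosyz Y)
    (hs : s ≫ E.δ Y = E.δ X ≫ f⟦(1 : ℤ)⟧') : (E.π.map f)⟦(1 : ℤ)⟧' = E.π.map s :=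
  E.suspMap_eq f s hs

/-- The triangle of the stable category with the given representatives in `K`. -/
noncomputable def imageTriangle {X Y Z : K} (f : X ⟶ Y) (g : Y ⟶ Z) (h : Z ⟶ E.cosyz X) : Triangle E.Stable :=
  Triangle.mk (Z := E.π.obj Z) (E.π.map f) (E.π.map g)
    (show E.π.obj Z ⟶ (E.π.obj X)⟦(1 : ℤ)⟧ from E.π.map h)

/-- `g : Y ⟶ Z` and `h : Z ⟶ ΣX` are obtained from `f : X ⟶ Y` by a homotopy pushout `Z` along the
preenvelope of `X`, as in the following morphism of distinguished triangles of `K`: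
```
  X ──ι──> env X ──p──> cosyz X ──δ──────> X⟦1⟧
  │f        │z            ║                 │f⟦1⟧
  Y ──g───> Z ────h───> cosyz X ──δ≫f⟦1⟧─> Y⟦1⟧
```
-/
def IsStableCone {X Y Z : K} (f : X ⟶ Y) (g : Y ⟶ Z) (h : Z ⟶ E.cosyz X) : Prop :=
  ∃ z : E.env X ⟶ Z, IsHomotopyCartesian (E.ι X) f z g ∧ z ≫ h = E.p X ∧
    Triangle.mk g h (E.δ X ≫ f⟦(1 : ℤ)⟧') ∈ distTriang K

/-- The distinguished triangles of the relative stable category: those isomorphic to the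
triangles given by homotopy pushouts along preenvelopes. -/
def distinguishedTriangles : Set (Triangle E.Stable) := fun T =>
  ∃ (X Y Z : K) (f : X ⟶ Y) (g : Y ⟶ Z) (h : Z ⟶ E.cosyz X),
    E.IsStableCone f g h ∧ Nonempty (T ≅ E.imageTriangle f g h)

/-- A morphism between image triangles from representatives of its components. -/
noncomputable def imageHom {X Y Z X' Y' Z' : K} {f : X ⟶ Y} {g : Y ⟶ Z} {h : Z ⟶ E.cosyz X}
    {f' : X' ⟶ Y'} {g' : Y' ⟶ Z'} {h' : Z' ⟶ E.cosyz X'} (a : X ⟶ X') (b : Y ⟶ Y') (c : Z ⟶ Z')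
    (h₁ : E.π.map f ≫ E.π.map b = E.π.map a ≫ E.π.map f')
    (h₂ : E.π.map g ≫ E.π.map c = E.π.map b ≫ E.π.map g')
    (h₃ : h ≫ E.δ X ≫ a⟦(1 : ℤ)⟧' = c ≫ h' ≫ E.δ X') :
    E.imageTriangle f g h ⟶ E.imageTriangle f' g' h' where
  hom₁ := E.π.map a
  hom₂ := E.π.map b
  hom₃ := E.π.map c
  comm₁ := h₁
  comm₂ := h₂
  comm₃ := by
    obtain ⟨s, hs⟩ := E.exists_susp a
    refine (congrArg (E.π.map h ≫ ·) (E.shift_map_eq a s hs)).trans ?_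
    refine (E.π.map_comp h s).symm.trans (Eq.trans ?_ (E.π.map_comp c h'))
    rw [π_map_eq_iff_comp_δ, assoc, assoc, hs, h₃]

lemma imageIso {X Y Z X' Y' Z' : K} {f : X ⟶ Y} {g : Y ⟶ Z} {h : Z ⟶ E.cosyz X}
    {f' : X' ⟶ Y'} {g' : Y' ⟶ Z'} {h' : Z' ⟶ E.cosyz X'} (a : X ⟶ X') (b : Y ⟶ Y') (c : Z ⟶ Z')
    (ha : IsIso (E.π.map a)) (hb : IsIso (E.π.map b)) (hc : IsIso (E.π.map c))
    (h₁ : E.π.map f ≫ E.π.map b = E.π.map a ≫ E.π.map f')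
    (h₂ : E.π.map g ≫ E.π.map c = E.π.map b ≫ E.π.map g')
    (h₃ : h ≫ E.δ X ≫ a⟦(1 : ℤ)⟧' = c ≫ h' ≫ E.δ X') :
    Nonempty (E.imageTriangle f g h ≅ E.imageTriangle f' g' h') :=
  have : IsIso (E.imageHom a b c h₁ h₂ h₃) := Triangle.isIso_of_isIsos _ ha hb hc
  ⟨asIso (E.imageHom a b c h₁ h₂ h₃)⟩

lemma distinguishedTriangles_of_iso {T T' : Triangle E.Stable} (e : Nonempty (T' ≅ T))
    (hT : T ∈ E.distinguishedTriangles) : T' ∈ E.distinguishedTriangles := by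
  obtain ⟨X, Y, Z, f, g, h, H, ⟨e'⟩⟩ := hT
  exact ⟨X, Y, Z, f, g, h, H, ⟨e.some ≪≫ e'⟩⟩

lemma exists_isStableCone [IsTriangulated K] {X Y : K} (f : X ⟶ Y) :
    ∃ (Z : K) (g : Y ⟶ Z) (h : Z ⟶ E.cosyz X), E.IsStableCone f g h := by
  obtain ⟨Z, z, g, h, H₁, H₂, H₃⟩ := exists_homotopy_pushout (E.dist_env X) f
  exact ⟨Z, g, h, z, H₁, H₂, H₃⟩

lemma imageTriangle_mem [IsTriangulated K] {X Y Z : K} {f : X ⟶ Y} {g : Y ⟶ Z}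
    {h : Z ⟶ E.cosyz X} (H : Triangle.mk g h (E.δ X ≫ f⟦(1 : ℤ)⟧') ∈ distTriang K) :
    E.imageTriangle f g h ∈ E.distinguishedTriangles := by
  obtain ⟨Z', g', h', H'⟩ := E.exists_isStableCone f
  have H₃ := H'
  obtain ⟨_, -, -, H₃⟩ := H₃
  refine ⟨X, Y, Z', f, g', h', H', ?_⟩
  obtain ⟨φ, hφ₁, hφ₂⟩ : ∃ φ : Z ≅ Z', g ≫ φ.hom = g' ∧ h = φ.hom ≫ h' := by
    let e := isoTriangleOfIso₁₃ _ _ H H₃ (Iso.refl _) (Iso.refl _) (by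
      change (E.δ X ≫ f⟦(1 : ℤ)⟧') ≫ (𝟙 Y)⟦(1 : ℤ)⟧' = 𝟙 _ ≫ (E.δ X ≫ f⟦(1 : ℤ)⟧')
      simp)
    refine ⟨Triangle.π₂.mapIso e, ?_, ?_⟩
    · exact e.hom.comm₁.trans (id_comp _)
    · exact (comp_id _).symm.trans e.hom.comm₂
  refine E.imageIso (𝟙 _) (𝟙 _) φ.hom inferInstance inferInstance inferInstance ?_ ?_ ?_
  · simp
  · rw [← E.π.map_comp, hφ₁]; simp
  · rw [hφ₂]; simp

lemma contractible_mem [IsTriangulated K] (A : E.Stable) :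
    contractibleTriangle A ∈ E.distinguishedTriangles := by
  obtain ⟨X, rfl⟩ : ∃ X : K, E.π.obj X = A := ⟨A.as, rfl⟩
  have H : Triangle.mk (E.ι X) (E.p X) (E.δ X ≫ (𝟙 X)⟦(1 : ℤ)⟧') ∈ distTriang K := by
    simpa using E.dist_env X
  refine E.distinguishedTriangles_of_iso ?_ (E.imageTriangle_mem H)
  have hz := E.isZero_of_proj (E.proj_of_inj (E.inj_env X))
  refine ⟨Triangle.isoMk _ _ (Iso.refl _) (Iso.refl _)
    ((isZero_zero _).iso hz) ?_ ?_ ?_⟩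
  · exact (comp_id _).trans ((E.π.map_id X).symm.trans (id_comp _).symm)
  · exact hz.eq_of_tgt _ _
  · exact (isZero_zero _).eq_of_src _ _

lemma exists_distinguished [IsTriangulated K] {A B : E.Stable} (φ : A ⟶ B) :
    ∃ (D : E.Stable) (g : B ⟶ D) (h : D ⟶ A⟦(1 : ℤ)⟧),
      Triangle.mk φ g h ∈ E.distinguishedTriangles := by
  obtain ⟨f, rfl⟩ := E.π.map_surjective (X := A.as) (Y := B.as) φ
  obtain ⟨Z, g, h, H⟩ := E.exists_isStableCone f
  exact ⟨E.π.obj Z, E.π.map g, E.π.map h, A.as, B.as, Z, f, g, h, H, ⟨Iso.refl _⟩⟩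

lemma complete_image {X Y Z X' Y' Z' : K} {f : X ⟶ Y} {g : Y ⟶ Z} {h : Z ⟶ E.cosyz X}
    {f' : X' ⟶ Y'} {g' : Y' ⟶ Z'} {h' : Z' ⟶ E.cosyz X'}
    (H : Triangle.mk g h (E.δ X ≫ f⟦(1 : ℤ)⟧') ∈ distTriang K)
    (H' : Triangle.mk g' h' (E.δ X' ≫ f'⟦(1 : ℤ)⟧') ∈ distTriang K)
    (a : E.π.obj X ⟶ E.π.obj X') (b : E.π.obj Y ⟶ E.π.obj Y')
    (w : E.π.map f ≫ b = a ≫ E.π.map f') :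
    ∃ φ : E.imageTriangle f g h ⟶ E.imageTriangle f' g' h', φ.hom₁ = a ∧ φ.hom₂ = b := by
  obtain ⟨a, rfl⟩ := E.π.map_surjective a
  obtain ⟨b, rfl⟩ := E.π.map_surjective b
  have w' := w
  rw [← E.π.map_comp, ← E.π.map_comp, π_map_eq_iff, Functor.map_comp, Functor.map_comp] at w'
  obtain ⟨s, hs⟩ := E.exists_susp a
  obtain ⟨c, hc₁, hc₂⟩ : ∃ c : Z ⟶ Z', g ≫ c = b ≫ g' ∧ h ≫ s = c ≫ h' :=
    complete_distinguished_triangle_morphism₂ _ _ H H' b s (by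
      change (E.δ X ≫ f⟦(1 : ℤ)⟧') ≫ b⟦(1 : ℤ)⟧' = s ≫ E.δ X' ≫ f'⟦(1 : ℤ)⟧'
      rw [assoc, w', reassoc_of% hs])
  refine ⟨E.imageHom a b c w ?_ ?_, rfl, rfl⟩
  · rw [← E.π.map_comp, hc₁, E.π.map_comp]
  · rw [← hs, ← assoc, hc₂, assoc]

lemma complete_image' {X Y Z X' Y' Z' : K} {f : X ⟶ Y} {g : Y ⟶ Z} {h : Z ⟶ E.cosyz X}
    {f' : X' ⟶ Y'} {g' : Y' ⟶ Z'} {h' : Z' ⟶ E.cosyz X'}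
    (H : Triangle.mk g h (E.δ X ≫ f⟦(1 : ℤ)⟧') ∈ distTriang K)
    (H' : Triangle.mk g' h' (E.δ X' ≫ f'⟦(1 : ℤ)⟧') ∈ distTriang K)
    (a : (E.imageTriangle f g h).obj₁ ⟶ (E.imageTriangle f' g' h').obj₁)
    (b : (E.imageTriangle f g h).obj₂ ⟶ (E.imageTriangle f' g' h').obj₂)
    (w : (E.imageTriangle f g h).mor₁ ≫ b = a ≫ (E.imageTriangle f' g' h').mor₁) :
    ∃ φ : E.imageTriangle f g h ⟶ E.imageTriangle f' g' h', φ.hom₁ = a ∧ φ.hom₂ = b :=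
  E.complete_image H H' a b w

lemma complete_distinguished (T T' : Triangle E.Stable) (hT : T ∈ E.distinguishedTriangles)
    (hT' : T' ∈ E.distinguishedTriangles) (a : T.obj₁ ⟶ T'.obj₁) (b : T.obj₂ ⟶ T'.obj₂)
    (w : T.mor₁ ≫ b = a ≫ T'.mor₁) :
    ∃ c : T.obj₃ ⟶ T'.obj₃, T.mor₂ ≫ c = b ≫ T'.mor₂ ∧ T.mor₃ ≫ a⟦(1 : ℤ)⟧' = c ≫ T'.mor₃ := by
  obtain ⟨X, Y, Z, f, g, h, ⟨_, -, -, H⟩, ⟨e⟩⟩ := hT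
  obtain ⟨X', Y', Z', f', g', h', ⟨_, -, -, H'⟩, ⟨e'⟩⟩ := hT'
  obtain ⟨φ, hφ₁, hφ₂⟩ := E.complete_image' H H' (e.inv.hom₁ ≫ a ≫ e'.hom.hom₁)
    (e.inv.hom₂ ≫ b ≫ e'.hom.hom₂) (by
      rw [e.inv.comm₁_assoc, reassoc_of% w, e'.hom.comm₁, assoc, assoc])
  let ψ := e.hom ≫ φ ≫ e'.inv
  have h₁ : ψ.hom₁ = a := by
    change e.hom.hom₁ ≫ φ.hom₁ ≫ e'.inv.hom₁ = a
    rw [hφ₁]; simp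
  have h₂ : ψ.hom₂ = b := by
    change e.hom.hom₂ ≫ φ.hom₂ ≫ e'.inv.hom₂ = b
    rw [hφ₂]; simp
  refine ⟨ψ.hom₃, ?_, ?_⟩
  · rw [← h₂]; exact ψ.comm₂
  · rw [← h₁]; exact ψ.comm₃

lemma exact₂_image {X Y Z : K} {f : X ⟶ Y} {g : Y ⟶ Z} {h : Z ⟶ E.cosyz X}
    (H : Triangle.mk g h (E.δ X ≫ f⟦(1 : ℤ)⟧') ∈ distTriang K) {B : E.Stable}
    (θ : E.π.obj Y ⟶ B) (hθ : E.π.map f ≫ θ = 0) :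
    ∃ ψ : E.π.obj Z ⟶ B, θ = E.π.map g ≫ ψ := by
  obtain ⟨B, rfl⟩ : ∃ Y : K, E.π.obj Y = B := ⟨B.as, rfl⟩
  obtain ⟨t, rfl⟩ := E.π.map_surjective θ
  rw [← E.π.map_comp, ← E.π.map_zero, π_map_eq_iff, Functor.map_comp, Functor.map_zero,
    comp_zero] at hθ
  obtain ⟨w, hw⟩ : ∃ w : Z⟦(1 : ℤ)⟧ ⟶ B⟦(1 : ℤ)⟧, t⟦(1 : ℤ)⟧' = (-g⟦(1 : ℤ)⟧') ≫ w :=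
    Triangle.yoneda_exact₂ _ (dist_rot.1 (dist_rot.1 H)) (t⟦(1 : ℤ)⟧') (by
      change (E.δ X ≫ f⟦(1 : ℤ)⟧') ≫ t⟦(1 : ℤ)⟧' = 0
      rw [assoc, hθ])
  obtain ⟨w, rfl⟩ := (shiftFunctor K (1 : ℤ)).map_surjective w
  refine ⟨E.π.map (-w), ?_⟩
  rw [← E.π.map_comp]
  congr 1
  apply (shiftFunctor K (1 : ℤ)).map_injective
  rw [hw, Functor.map_comp, Functor.map_neg, Preadditive.neg_comp, Preadditive.comp_neg]

lemma exact₂ (T : Triangle E.Stable) (hT : T ∈ E.distinguishedTriangles) {B : E.Stable}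
    (φ : T.obj₂ ⟶ B) (hφ : T.mor₁ ≫ φ = 0) : ∃ ψ : T.obj₃ ⟶ B, φ = T.mor₂ ≫ ψ := by
  obtain ⟨X, Y, Z, f, g, h, ⟨_, -, -, H⟩, ⟨e⟩⟩ := hT
  obtain ⟨ψ, hψ⟩ : ∃ ψ : (E.imageTriangle f g h).obj₃ ⟶ B,
      e.inv.hom₂ ≫ φ = (E.imageTriangle f g h).mor₂ ≫ ψ :=
    E.exact₂_image H _ (by
      change (E.imageTriangle f g h).mor₁ ≫ e.inv.hom₂ ≫ φ = 0
      rw [e.inv.comm₁_assoc, hφ, comp_zero])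
  refine ⟨e.hom.hom₃ ≫ ψ, ?_⟩
  rw [e.hom.comm₂_assoc, ← hψ]
  simp

lemma isIso_of_comparison {A B D : E.Stable} {f : A ⟶ B} {g : B ⟶ D} {h : D ⟶ A⟦(1 : ℤ)⟧}
    (H : Triangle.mk g h (-f⟦(1 : ℤ)⟧') ∈ E.distinguishedTriangles) (e : D ⟶ D)
    (h₁ : g ≫ e = g) (h₂ : e ≫ h = h) : IsIso e := by
  obtain ⟨w, hw⟩ : ∃ w : A⟦(1 : ℤ)⟧ ⟶ D, e - 𝟙 _ = h ≫ w :=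
    E.exact₂ _ H (e - 𝟙 D) (show g ≫ (e - 𝟙 D) = 0 by
      rw [Preadditive.comp_sub, h₁, comp_id, sub_self])
  have hsq : (e - 𝟙 _) ≫ (e - 𝟙 _) = 0 := by
    nth_rw 2 [hw]
    rw [← assoc, Preadditive.sub_comp, h₂, id_comp, sub_self, zero_comp]
  have hsq' : e ≫ e = e + e - 𝟙 _ := by
    simp only [Preadditive.sub_comp, Preadditive.comp_sub, id_comp, comp_id] at hsq
    rw [← sub_eq_zero, ← hsq]
    abel
  refine ⟨𝟙 _ + 𝟙 _ - e, ?_, ?_⟩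
  · rw [Preadditive.comp_sub, Preadditive.comp_add, comp_id, hsq']; abel
  · rw [Preadditive.sub_comp, Preadditive.add_comp, id_comp, hsq']; abel

lemma map_comp_shift_map {X Y Z : K} (s : Z ⟶ E.cosyz X) (f : X ⟶ Y) (t : E.cosyz X ⟶ E.cosyz Y)
    (ht : t ≫ E.δ Y = E.δ X ≫ f⟦(1 : ℤ)⟧') :
    (show E.π.obj Z ⟶ (E.π.obj X)⟦(1 : ℤ)⟧ from E.π.map s) ≫ (E.π.map f)⟦(1 : ℤ)⟧' =
      E.π.map (s ≫ t) :=
  (congrArg (E.π.map s ≫ ·) (E.shift_map_eq f t ht)).trans (E.π.map_comp s t).symm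

end FrobeniusClass

namespace FrobeniusClass

variable (E : FrobeniusClass K) [IsTriangulated K]

lemma isPhantom_of_comp_ι {X Z : K} (k : Z ⟶ X⟦(1 : ℤ)⟧) (hk : k ≫ (E.ι X)⟦(1 : ℤ)⟧' = 0) :
    IsPhantomFor E.tri k := by
  obtain ⟨s, hs⟩ : ∃ s : Z ⟶ E.cosyz X, k = s ≫ E.δ X :=
    Triangle.coyoneda_exact₁ _ (E.dist_env X) k hk
  rw [hs]
  exact E.isPhantom_precomp (E.phantom_δ X) s

lemma isPhantom_δ_comp {X Y : K} (f : X ⟶ Y) : IsPhantomFor E.tri (E.δ X ≫ f⟦(1 : ℤ)⟧') := by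
  apply E.isPhantom_of_comp_ι
  rw [assoc, ← Functor.map_comp]
  exact E.phantom_comp_of_inj (E.inj_env Y) (E.phantom_δ X) _

/-- The triangles of `E` induce distinguished triangles of the stable category. -/
lemma imageTriangle_mem_of_tri {X Y Z : K} {f : X ⟶ Y} {g : Y ⟶ Z} {h : Z ⟶ X⟦(1 : ℤ)⟧}
    (H : E.tri (Triangle.mk f g h)) (s : Z ⟶ E.cosyz X) (hs : s ≫ E.δ X = h) :
    E.imageTriangle f g (-s) ∈ E.distinguishedTriangles := by
  obtain ⟨W, f', g', b, H₁, H₂, H₃⟩ := exists_homotopy_pullback (E.dist_env X) s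
  have H₄ := E.imageTriangle_mem
    (f := f') (g := biprod.lift g' b) (h := -biprod.desc s (-E.p X)) (by simpa using dist_neg₂₃ H₂)
  refine E.distinguishedTriangles_of_iso ?_ H₄
  obtain ⟨φ, hφ₁, hφ₂⟩ : ∃ φ : Y ≅ W, f ≫ φ.hom = f' ∧ g = φ.hom ≫ g' := by
    let e := isoTriangleOfIso₁₃ _ _ (E.distinguished _ H) H₁ (Iso.refl _) (Iso.refl _) (by
      change h ≫ (𝟙 X)⟦(1 : ℤ)⟧' = 𝟙 _ ≫ s ≫ E.δ X
      simp [hs])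
    refine ⟨Triangle.π₂.mapIso e, ?_, ?_⟩
    · exact e.hom.comm₁.trans (id_comp _)
    · exact (comp_id _).symm.trans e.hom.comm₂
  have hz : E.π.map (biprod.snd : Z ⊞ E.env X ⟶ _) = 0 :=
    (E.isZero_of_proj (E.proj_of_inj (E.inj_env X))).eq_of_tgt _ _
  have ht : E.π.map (biprod.fst ≫ biprod.inl : Z ⊞ E.env X ⟶ _) = 𝟙 _ := by
    rw [← E.π.map_id, ← biprod.total, E.π.map_add, E.π.map_comp biprod.snd, hz, zero_comp,
      add_zero]
  have hi : IsIso (E.π.map (biprod.inl : Z ⟶ Z ⊞ E.env X)) :=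
    ⟨E.π.map biprod.fst, by rw [← E.π.map_comp, biprod.inl_fst, E.π.map_id],
      by rw [← E.π.map_comp, ht]⟩
  refine E.imageIso (𝟙 _) φ.hom biprod.inl inferInstance inferInstance hi ?_ ?_ ?_
  · rw [← E.π.map_comp, hφ₁]; simp
  · have : E.π.map (biprod.lift g' b) = E.π.map g' ≫ E.π.map biprod.inl := by
      rw [← comp_id (E.π.map (biprod.lift g' b)), ← ht, ← E.π.map_comp, biprod.lift_fst_assoc,
        E.π.map_comp]
    rw [this, hφ₂, E.π.map_comp, assoc]
  · simp

lemma rotate_mem (T : Triangle E.Stable) (hT : T ∈ E.distinguishedTriangles) :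
    T.rotate ∈ E.distinguishedTriangles := by
  obtain ⟨X, Y, Z, f, g, h, ⟨_, -, -, H⟩, ⟨e⟩⟩ := hT
  obtain ⟨s, hs⟩ := E.exists_susp f
  have H' := E.imageTriangle_mem_of_tri (E.tri_of_isPhantom H (E.isPhantom_δ_comp f)) s hs
  refine E.distinguishedTriangles_of_iso
    (T := E.imageTriangle g h (-s)) ⟨(rotate E.Stable).mapIso e ≪≫ ?_⟩ H'
  refine Triangle.isoMk _ _ (Iso.refl _) (Iso.refl _) (Iso.refl _) ?_ ?_ ?_
  · exact (comp_id _).trans (id_comp _).symm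
  · exact (comp_id _).trans (id_comp _).symm
  · have h₁ : -(E.π.map f)⟦(1 : ℤ)⟧' = E.π.map (-s) := by
      rw [E.shift_map_eq f s hs]
      exact (E.π.map_neg).symm
    refine (congrArg (_ ≫ ·) (CategoryTheory.Functor.map_id _ _)).trans ?_
    exact (comp_id _).trans (h₁.trans (id_comp _).symm)

lemma exists_comparison {A B D D₀ : E.Stable} {f : A ⟶ B} {g : B ⟶ D} {h : D ⟶ A⟦(1 : ℤ)⟧}
    {g₀ : B ⟶ D₀} {h₀ : D₀ ⟶ A⟦(1 : ℤ)⟧}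
    (H : Triangle.mk g h (-f⟦(1 : ℤ)⟧') ∈ E.distinguishedTriangles)
    (H₀ : Triangle.mk g₀ h₀ (-f⟦(1 : ℤ)⟧') ∈ E.distinguishedTriangles) :
    ∃ c : D ⟶ D₀, g ≫ c = g₀ ∧ c ≫ h₀ = h := by
  have R := E.rotate_mem _ (E.rotate_mem _ H)
  have R₀ := E.rotate_mem _ (E.rotate_mem _ H₀)
  obtain ⟨c', hc₁, hc₂⟩ : ∃ c' : D⟦(1 : ℤ)⟧ ⟶ D₀⟦(1 : ℤ)⟧,
      (-g⟦(1 : ℤ)⟧') ≫ c' = 𝟙 _ ≫ (-g₀⟦(1 : ℤ)⟧') ∧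
      (-h⟦(1 : ℤ)⟧') ≫ (𝟙 (A⟦(1 : ℤ)⟧))⟦(1 : ℤ)⟧' = c' ≫ (-h₀⟦(1 : ℤ)⟧') :=
    E.complete_distinguished _ _ R R₀ (𝟙 _) (𝟙 _) ((comp_id _).trans (id_comp _).symm)
  obtain ⟨c, rfl⟩ := (shiftFunctor E.Stable (1 : ℤ)).map_surjective c'
  refine ⟨c, ?_, ?_⟩
  · apply (shiftFunctor E.Stable (1 : ℤ)).map_injective
    rw [Functor.map_comp]
    simpa using hc₁
  · apply (shiftFunctor E.Stable (1 : ℤ)).map_injective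
    rw [Functor.map_comp]
    simpa using hc₂.symm

lemma rotate_mem_iff (T : Triangle E.Stable) :
    T ∈ E.distinguishedTriangles ↔ T.rotate ∈ E.distinguishedTriangles := by
  refine ⟨E.rotate_mem T, fun hT => ?_⟩
  obtain ⟨A, B, D, f, g, h⟩ := T
  obtain ⟨D₀, g₀, h₀, H₀⟩ := E.exists_distinguished f
  have R : Triangle.mk g h (-f⟦(1 : ℤ)⟧') ∈ E.distinguishedTriangles := hT
  have R₀ : Triangle.mk g₀ h₀ (-f⟦(1 : ℤ)⟧') ∈ E.distinguishedTriangles := E.rotate_mem _ H₀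
  obtain ⟨c, hc₁, hc₂⟩ := E.exists_comparison R R₀
  obtain ⟨d, hd₁, hd₂⟩ := E.exists_comparison R₀ R
  have i₁ : IsIso (c ≫ d) := E.isIso_of_comparison R _ (by rw [reassoc_of% hc₁, hd₁])
    (by rw [assoc, hd₂, hc₂])
  have i₂ : IsIso (d ≫ c) := E.isIso_of_comparison R₀ _ (by rw [reassoc_of% hd₁, hc₁])
    (by rw [assoc, hc₂, hd₂])
  have m : Mono c := mono_of_mono c d
  have s : IsSplitEpi c := IsSplitEpi.mk' ⟨inv (d ≫ c) ≫ d, by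
    rw [assoc]; exact IsIso.inv_hom_id (d ≫ c)⟩
  have : IsIso c := isIso_of_mono_of_isSplitEpi c
  let ec : D ≅ D₀ := asIso c
  refine E.distinguishedTriangles_of_iso ?_ H₀
  exact ⟨Triangle.isoMk _ _ (Iso.refl _) (Iso.refl _) ec
    ((comp_id _).trans (id_comp _).symm) (hc₁.trans (id_comp _).symm)
    ((congrArg (h ≫ ·) (CategoryTheory.Functor.map_id _ _)).trans ((comp_id _).trans hc₂.symm))⟩

/-- The relative stable category is pretriangulated. -/
instance : Pretriangulated E.Stable where
  distinguishedTriangles := E.distinguishedTriangles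
  isomorphic_distinguished _ hT _ e := E.distinguishedTriangles_of_iso ⟨e⟩ hT
  contractible_distinguished := E.contractible_mem
  distinguished_cocone_triangle := E.exists_distinguished
  rotate_distinguished_triangle := E.rotate_mem_iff
  complete_distinguished_triangle_morphism := E.complete_distinguished

lemma tri_of_extends {X Y Z : K} {m : X ⟶ Y} {v : Y ⟶ Z} {w : Z ⟶ X⟦(1 : ℤ)⟧}
    (H : Triangle.mk m v w ∈ distTriang K) (r : Y ⟶ E.env X) (hr : m ≫ r = E.ι X) :
    E.tri (Triangle.mk m v w) := by
  refine E.tri_of_isPhantom H (E.isPhantom_of_comp_ι w ?_)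
  have h : w ≫ m⟦(1 : ℤ)⟧' = 0 := comp_distTriang_mor_zero₃₁ _ H
  rw [← hr, Functor.map_comp, reassoc_of% h, zero_comp]

/-- Every morphism of the stable category is represented by the first morphism of a triangle
of `E`. -/
lemma exists_mono_representative {X : K} {B : E.Stable} (φ : E.π.obj X ⟶ B) :
    ∃ (M Z : K) (m : X ⟶ M) (v : M ⟶ Z) (w : Z ⟶ X⟦(1 : ℤ)⟧) (e : B ≅ E.π.obj M),
      E.tri (Triangle.mk m v w) ∧ φ ≫ e.hom = E.π.map m := by
  obtain ⟨Y, rfl⟩ : ∃ Y : K, E.π.obj Y = B := ⟨B.as, rfl⟩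
  obtain ⟨f, rfl⟩ := E.π.map_surjective φ
  obtain ⟨Z, v, w, H⟩ := distinguished_cocone_triangle (biprod.lift f (E.ι X))
  have hz : E.π.map (biprod.snd : Y ⊞ E.env X ⟶ _) = 0 :=
    (E.isZero_of_proj (E.proj_of_inj (E.inj_env X))).eq_of_tgt _ _
  have ht : E.π.map (biprod.fst ≫ biprod.inl : Y ⊞ E.env X ⟶ _) = 𝟙 _ := by
    rw [← E.π.map_id, ← biprod.total, E.π.map_add, E.π.map_comp biprod.snd, hz, zero_comp,
      add_zero]
  refine ⟨_, Z, _, v, w, ⟨E.π.map biprod.inl, E.π.map biprod.fst, ?_, ?_⟩,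
    E.tri_of_extends H biprod.snd (biprod.lift_snd _ _), ?_⟩
  · rw [← E.π.map_comp, biprod.inl_fst, E.π.map_id]
  · rw [← E.π.map_comp, ht]
  · change E.π.map f ≫ E.π.map biprod.inl = _
    rw [← comp_id (E.π.map (biprod.lift _ _)), ← ht, ← E.π.map_comp, ← E.π.map_comp,
      biprod.lift_fst_assoc]

lemma mk_mem_of_tri {X Y Z : K} {f : X ⟶ Y} {g : Y ⟶ Z} {h : Z ⟶ X⟦(1 : ℤ)⟧}
    (H : E.tri (Triangle.mk f g h)) (s : Z ⟶ E.cosyz X) (hs : s ≫ E.δ X = h)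
    (σ : E.π.obj Z ⟶ (E.π.obj X)⟦(1 : ℤ)⟧) (hσ : σ = E.π.map (-s)) :
    Triangle.mk (E.π.map f) (E.π.map g) σ ∈ distTriang E.Stable := by
  subst hσ
  exact E.imageTriangle_mem_of_tri H s hs

/-- The relative stable category is triangulated. -/
instance : IsTriangulated E.Stable := IsTriangulated.mk' (by
  intro X₁ X₂ X₃ φ ψ
  obtain ⟨X₁, rfl⟩ : ∃ X : K, E.π.obj X = X₁ := ⟨X₁.as, rfl⟩
  obtain ⟨M₂, Z₁₂, m₁, v₁₂, w₁₂, e₂, T₁₂, hφ⟩ := E.exists_mono_representative φ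
  obtain ⟨M₃, Z₂₃, m₂, v₂₃, w₂₃, e₃, T₂₃, hψ⟩ := E.exists_mono_representative (e₂.inv ≫ ψ)
  obtain ⟨Z₁₃, v₁₃, w₁₃, H₁₃⟩ := distinguished_cocone_triangle (m₁ ≫ m₂)
  have T₁₃ : E.tri (Triangle.mk (m₁ ≫ m₂) v₁₃ w₁₃) := by
    obtain ⟨r, hr⟩ := E.inj_extend (E.inj_env _) T₁₂ (E.ι X₁)
    obtain ⟨r', hr'⟩ := E.inj_extend (E.inj_env _) T₂₃ r
    exact E.tri_of_extends H₁₃ r' (by rw [assoc, hr', hr])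
  let o := Triangulated.someOctahedron rfl (E.distinguished _ T₁₂) (E.distinguished _ T₂₃) H₁₃
  obtain ⟨s₁₂, hs₁₂⟩ := E.exists_lift_δ ⟨_, _, _, T₁₂⟩
  obtain ⟨s₂₃, hs₂₃⟩ := E.exists_lift_δ ⟨_, _, _, T₂₃⟩
  obtain ⟨s₁₃, hs₁₃⟩ := E.exists_lift_δ ⟨_, _, _, T₁₃⟩
  obtain ⟨t, ht⟩ := E.exists_susp m₁
  obtain ⟨t', ht'⟩ := E.exists_susp v₁₂
  have T : E.tri (Triangle.mk o.m₁ o.m₃ (w₂₃ ≫ v₁₂⟦(1 : ℤ)⟧')) := by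
    refine E.tri_of_isPhantom o.mem ?_
    rw [← hs₂₃, assoc]
    exact E.isPhantom_precomp (E.isPhantom_δ_comp v₁₂) s₂₃
  refine ⟨E.π.obj X₁, E.π.obj M₂, E.π.obj M₃, E.π.obj Z₁₂, E.π.obj Z₂₃, E.π.obj Z₁₃,
    E.π.map m₁, E.π.map m₂, Iso.refl _, e₂, e₃, ?_, ?_,
    E.π.map v₁₂, E.π.map (-s₁₂), E.mk_mem_of_tri T₁₂ s₁₂ hs₁₂ _ rfl,
    E.π.map v₂₃, E.π.map (-s₂₃), E.mk_mem_of_tri T₂₃ s₂₃ hs₂₃ _ rfl,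
    E.π.map v₁₃, E.π.map (-s₁₃), ?_, ⟨⟨E.π.map o.m₁, E.π.map o.m₃, ?_, ?_, ?_, ?_, ?_⟩⟩⟩
  · rw [hφ, Iso.refl_hom, id_comp]
  · rw [← hψ, assoc, e₂.hom_inv_id_assoc]
  · rw [← E.π.map_comp]
    exact E.mk_mem_of_tri T₁₃ s₁₃ hs₁₃ _ rfl
  · rw [← E.π.map_comp, ← E.π.map_comp, o.comm₁]
  · have key : (o.m₁ ≫ (-s₁₃)) ≫ E.δ X₁ = (-s₁₂) ≫ E.δ X₁ := by
      have := o.comm₂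
      simp [hs₁₃, hs₁₂, this]
    exact (E.π.map_comp _ _).symm.trans ((E.π_map_eq_iff_comp_δ _ _).2 key)
  · rw [← E.π.map_comp, o.comm₃]
  · have key : ((-s₁₃) ≫ t) ≫ E.δ M₂ = (o.m₃ ≫ (-s₂₃)) ≫ E.δ M₂ := by
      have := o.comm₄
      simp [ht, reassoc_of% hs₁₃, hs₂₃, this]
    exact (E.map_comp_shift_map (-s₁₃) m₁ t ht).trans
      (((E.π_map_eq_iff_comp_δ _ _).2 key).trans (E.π.map_comp _ _))
  · refine E.mk_mem_of_tri T (s₂₃ ≫ t') (by rw [assoc, ht', reassoc_of% hs₂₃]) _ ?_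
    rw [← Preadditive.neg_comp]
    exact E.map_comp_shift_map (-s₂₃) v₁₂ t' ht')

end FrobeniusClass

/-- A summand-closed additive subcategory: a full subcategory that contains zero and is closed
under finite direct sums and direct summands (hence under isomorphisms). -/
structure IsSummandClosedAdditive (C : ObjectProperty K) : Prop where
  zero : C.ContainsZero
  sum : C.IsClosedUnderBinaryProducts
  summand : C.IsStableUnderRetracts

/-- A thick subcategory: a triangulated subcategory closed under direct summands. -/
structure IsThick (C : ObjectProperty K) : Prop where
  triangulated : C.IsTriangulated
  summand : C.IsStableUnderRetracts

namespace FrobeniusClass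

variable (E : FrobeniusClass K)

/-- The `E`-two-out-of-three property: if two of the objects of a triangle of `E` belong to `C`,
then so does the third. -/
structure TwoOutOfThree (C : ObjectProperty K) : Prop where
  third : ∀ T : Triangle K, E.tri T → C T.obj₁ → C T.obj₂ → C T.obj₃
  second : ∀ T : Triangle K, E.tri T → C T.obj₁ → C T.obj₃ → C T.obj₂
  first : ∀ T : Triangle K, E.tri T → C T.obj₂ → C T.obj₃ → C T.obj₁

variable [IsTriangulated K]

/-- The functor `π` induces an exact equivalence from the Verdier quotient of `K` by `C` to the
Verdier quotient of the relative stable category by the (essential) image of `C`. -/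
def InducesExactEquivalence (C : ObjectProperty K) [C.IsTriangulated]
    [(C.map E.π).IsTriangulated] : Prop :=
  ∃ F : C.trW.Localization ⥤ (C.map E.π).trW.Localization,
    Nonempty (C.trW.Q ⋙ F ≅ E.π ⋙ (C.map E.π).trW.Q) ∧ F.IsEquivalence ∧
    ∃ _ : F.CommShift ℤ, F.IsTriangulated

end FrobeniusClass
end RelStable

/-! Write `I_X` for `E.env X` and `X'` for `E.cosyz X`, which represents the suspension of `X` in
the stable category.

Item 1 is a dictionary between `C` and `π(C)`. A retraction in the stable category lifts to a
retraction in `K` after adding a projective summand, so `π X` lies in `π(C)` exactly when `X` lies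
in `C` (`map_π_obj_iff`). Triangles of `E` become stable triangles; conversely, a stable triangle on
`f : X ⟶ Y` comes from a triangle `Y ⟶ Z ⟶ X' ⟶ Y⟦1⟧` whose last map `δ_X ≫ f⟦1⟧` is a phantom, so
that it lies in `E`.

Items 2 and 3 rest on `exists_tri_of_distinguished`. For any distinguished triangle `X ⟶ Y ⟶ Z` with
first map `f`, the map `(f, ι_X) : X ⟶ Y ⊞ I_X` starts a triangle of `E`, with cone `Z'`, and the
octahedral axiom gives a triangle `Z' ⟶ Z ⟶ I_X⟦1⟧`. Thus arbitrary triangles agree with triangles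
of `E` up to shifted projectives, which all lie in `thick(proj E)`.

For item 3, `π` is itself a localization, and a morphism has cone in `C` if and only if its image
has cone in `π(C)` (`trW_π_map_iff`). Hence `K` followed by both quotients is a localization of `K`
at `C.trW`, and uniqueness of localizations gives the equivalence. For exactness, `δ_X : X' ⟶ X⟦1⟧`
has cone `I_X⟦1⟧` and so becomes invertible; its negative compares the two suspensions, and every
distinguished triangle becomes isomorphic to one of `E`. Since the `ℤ`-shift of the stable category
consists of powers of the suspension, a comparison for the shift by 1 must be extended coherently to
all integers; orbits do this (`commShiftOfOne`). -/

namespace RelStable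

/-! ### From commutation with the shift by 1 to commutation with all shifts -/

section CommShiftOfOne

universe v₁ v₂ u₁ u₂

namespace Orbit

section

variable {D : Type u₂} [Category.{v₂} D] {e : D ≌ D}

lemma shiftFunctorZero_inv_app_f (A : Orbit e) (n : ℤ) :
    Hom.f ((shiftFunctorZero (Orbit e) ℤ).inv.app A) n = (A.cast (zero_add n).symm).hom := by
  rw [ShiftMkCore.shiftFunctorZero_eq]
  rfl

lemma shiftFunctorAdd_inv_app_f (A : Orbit e) (a b n : ℤ) :
    Hom.f ((shiftFunctorAdd (Orbit e) a b).inv.app A) n =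
      (A.cast (add_assoc a b n).symm).hom := by
  rw [ShiftMkCore.shiftFunctorAdd_eq]
  rfl

end

variable {C : Type u₁} [Category.{v₁} C] {D : Type u₂} [Category.{v₂} D] [HasShift C ℤ]
  [HasShift D ℤ] (F : C ⥤ D) (τ : shiftFunctor C (1 : ℤ) ⋙ F ≅ F ⋙ shiftFunctor D (1 : ℤ))

/-- Naturality of `τ.inv` with a trailing factor: the shape taken by the compatibility squares of
orbit morphisms between the `ofShifts`. -/
lemma map_shift_comp_inv {X Y : C} (g : X ⟶ Y) {Z : C} (k : Y⟦(1 : ℤ)⟧ ⟶ Z) :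
    (F.map g)⟦(1 : ℤ)⟧' ≫ τ.inv.app Y ≫ F.map k = τ.inv.app X ≫ F.map (g⟦(1 : ℤ)⟧' ≫ k) := by
  have := τ.inv.naturality g
  dsimp at this
  rw [reassoc_of% this, F.map_comp]

/-- The images under `F` of the shifts of an object form an orbit, if `F` commutes with the
shift by `1`. -/
noncomputable def ofShifts : C ⥤ Orbit (shiftEquiv D (1 : ℤ)) where
  obj c :=
    { X := fun n => F.obj (c⟦n⟧)
      σ := fun n n' h => (τ.app (c⟦n⟧)).symm ≪≫
        F.mapIso ((shiftFunctorAdd' C n 1 n' h).app c).symm }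
  map {c d} g :=
    { f := fun n => F.map (g⟦n⟧')
      comm := by
        intro n n' h
        refine (map_shift_comp_inv F τ (g⟦n⟧') _).trans (Eq.trans ?_ (assoc _ _ _).symm)
        refine congrArg (τ.inv.app _ ≫ ·) (Eq.trans ?_ (F.map_comp _ _))
        exact congrArg F.map ((shiftFunctorAdd' C n 1 n' h).inv.naturality g) }
  map_id c := hom_ext _ _ fun n =>
    (congrArg F.map ((shiftFunctor C n).map_id c)).trans (F.map_id _)
  map_comp f g := hom_ext _ _ fun n =>
    (congrArg F.map ((shiftFunctor C n).map_comp f g)).trans (F.map_comp _ _)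

/-- `shiftFunctorAdd'` carries its own proof of the index equation and therefore absorbs the casts
between equal indices that the shift of orbits introduces. -/
lemma ofShifts_cast (c : C) {n m k k' : ℤ} (h : m + n = k) (h' : k = k') :
    F.map ((shiftFunctorAdd' C m n k h).inv.app c) ≫ (((ofShifts F τ).obj c).cast h').hom =
      F.map ((shiftFunctorAdd' C m n k' (h.trans h')).inv.app c) := by
  subst h'
  exact comp_id _

/-- The components of the compatibility of `ofShifts` with the shift by `m`. -/
noncomputable def ofShiftsHom (m : ℤ) (c : C) :
    (ofShifts F τ).obj (c⟦m⟧) ⟶ ((ofShifts F τ).obj c)⟦m⟧ where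
  f n := F.map ((shiftFunctorAdd' C m n (m + n) rfl).inv.app c)
  comm n n' h := by
    refine (map_shift_comp_inv F τ _ _).trans (Eq.trans ?_ (assoc _ _ _).symm)
    refine congrArg (τ.inv.app _ ≫ ·) (Eq.trans ?_ (F.map_comp _ _))
    exact congrArg F.map
      (shiftFunctorAdd'_assoc_inv_app m n 1 (m + n) n' (m + n') rfl h (by omega) c)

/-- The components of the inverse of the compatibility of `ofShifts` with the shift by `m`. -/
noncomputable def ofShiftsInv (m : ℤ) (c : C) :
    ((ofShifts F τ).obj c)⟦m⟧ ⟶ (ofShifts F τ).obj (c⟦m⟧) where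
  f n := F.map ((shiftFunctorAdd' C m n (m + n) rfl).hom.app c)
  comm n n' h := by
    refine (map_shift_comp_inv F τ _ _).trans (Eq.trans ?_ (assoc _ _ _).symm)
    refine congrArg (τ.inv.app _ ≫ ·) (Eq.trans ?_ (F.map_comp _ _))
    refine congrArg F.map ?_
    dsimp
    -- Composing with an inverse reduces the square to the associativity law for the `inv`
    -- components, the one used for `ofShiftsHom`.
    rw [← cancel_mono ((shiftFunctorAdd' C m n' (m + n') rfl).inv.app c), assoc,
      ← shiftFunctorAdd'_assoc_inv_app m n 1 (m + n) n' (m + n') rfl h (by omega),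
      ← Functor.map_comp_assoc]
    simp

/-- The compatibility of `ofShifts` with the shift by `m`. -/
noncomputable def ofShiftsIso (m : ℤ) : shiftFunctor C m ⋙ ofShifts F τ ≅
    ofShifts F τ ⋙ shiftFunctor (Orbit (shiftEquiv D (1 : ℤ))) m :=
  NatIso.ofComponents (fun c =>
    { hom := ofShiftsHom F τ m c
      inv := ofShiftsInv F τ m c
      hom_inv_id := hom_ext _ _ fun _ => (F.map_comp _ _).symm.trans
        ((congrArg F.map (Iso.inv_hom_id_app _ _)).trans (F.map_id _))
      inv_hom_id := hom_ext _ _ fun _ => (F.map_comp _ _).symm.trans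
        ((congrArg F.map (Iso.hom_inv_id_app _ _)).trans (F.map_id _)) })
    (fun g => hom_ext _ _ fun n => (F.map_comp _ _).symm.trans
      ((congrArg F.map ((shiftFunctorAdd' C m n (m + n) rfl).inv.naturality g)).trans
        (F.map_comp _ _)))

/-- Checked index by index, the coherence axioms are the unit and associativity laws of the shift of
`C`. The isomorphism `τ` occurs only in the structure maps of the orbits and plays no role in these
equations. -/
noncomputable instance : (ofShifts F τ).CommShift ℤ where
  commShiftIso := ofShiftsIso F τ
  commShiftIso_zero := by
    ext c : 3
    refine hom_ext _ _ fun n => ?_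
    rw [Functor.CommShift.isoZero_hom_app, comp_f, shiftFunctorZero_inv_app_f]
    refine Eq.trans ?_ (congrArg (· ≫ _) (congrArg F.map
      (shiftFunctorAdd'_zero_add_inv_app n c)))
    exact (ofShifts_cast F τ c _ _).symm
  commShiftIso_add a b := by
    ext c : 3
    refine hom_ext _ _ fun n => ?_
    rw [Functor.CommShift.isoAdd_hom_app, comp_f, comp_f, comp_f, shiftFunctorAdd_inv_app_f]
    refine Eq.trans ?_ (congrArg (_ ≫ ·) (congrArg (_ ≫ ·)
      (ofShifts_cast F τ c (rfl : a + (b + n) = _) (add_assoc a b n).symm).symm))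
    refine Eq.trans (congrArg F.map ?_) ((F.map_comp _ _).trans
      (congrArg (_ ≫ ·) (F.map_comp _ _)))
    rw [← cancel_epi (((shiftFunctorAdd C a b).inv.app c)⟦n⟧'),
      ← Functor.map_comp_assoc, Iso.inv_hom_id_app, ← shiftFunctorAdd'_eq_shiftFunctorAdd,
      shiftFunctorAdd'_assoc_inv_app a b n (a + b) (b + n) (a + b + n) rfl rfl rfl]
    simp

variable (D) in
/-- The functor sending an object to the orbit of its shifts. -/
noncomputable abbrev shifts : D ⥤ Orbit (shiftEquiv D (1 : ℤ)) :=
  ofShifts (𝟭 D) (Iso.refl _)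

variable (D) in
/-- The functor sending an object to the orbit of its shifts is fully faithful. -/
noncomputable def shiftsFullyFaithful : (shifts D).FullyFaithful where
  preimage φ := (shiftFunctor D (0 : ℤ)).preimage (φ.f 0)
  map_preimage _ := ev_injective _ _ ((shiftFunctor D (0 : ℤ)).map_preimage _)
  preimage_map g := (shiftFunctor D (0 : ℤ)).preimage_map g

instance : (shifts D).Full := (shiftsFullyFaithful D).full

instance : (shifts D).Faithful := (shiftsFullyFaithful D).faithful

/-- The orbit of the shifts of `F.obj c` is the image under `F` of the orbit of the shifts
of `c`. -/
noncomputable def compShiftsIso : F ⋙ shifts D ≅ ofShifts F τ :=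
  NatIso.ofComponents (fun c => (evFullyFaithful _).preimageIso
    ((shiftFunctorZero D ℤ).app (F.obj c) ≪≫ F.mapIso ((shiftFunctorZero C ℤ).app c).symm))
    (fun g => ev_injective _ _ (by
      have h₁ := (shiftFunctorZero D ℤ).hom.naturality (F.map g)
      have h₂ := congrArg F.map ((shiftFunctorZero C ℤ).inv.naturality g)
      rw [F.map_comp, F.map_comp] at h₂
      refine (assoc _ _ _).symm.trans ((congrArg (· ≫ _) h₁).trans ((assoc _ _ _).trans ?_))
      refine Eq.trans ?_ (assoc _ _ _).symm
      exact congrArg (_ ≫ ·) h₂))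

lemma compShiftsIso_hom_app_f_zero (c : C) :
    Hom.f ((compShiftsIso F τ).hom.app c) 0 =
      (shiftFunctorZero D ℤ).hom.app (F.obj c) ≫ F.map ((shiftFunctorZero C ℤ).inv.app c) :=
  rfl

/-- The component at 0 is made of zero-shift isomorphisms. In the orbit square from index 0 to index
1 these cancel against the addition isomorphisms for `0 + 1`, and only the structure map of the
target remains, which is `τ.inv`. -/
lemma compShiftsIso_hom_app_f_one (c : C) :
    Hom.f ((compShiftsIso F τ).hom.app c) 1 = τ.inv.app c := by
  have h := Hom.comm ((compShiftsIso F τ).hom.app c) 0 1 (zero_add 1)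
  rw [compShiftsIso_hom_app_f_zero] at h
  have h' : ((shiftFunctorZero D ℤ).hom.app (F.obj c) ≫
      F.map ((shiftFunctorZero C ℤ).inv.app c))⟦(1 : ℤ)⟧' ≫ τ.inv.app (c⟦(0 : ℤ)⟧) ≫
        F.map ((shiftFunctorAdd' C 0 1 1 (zero_add 1)).inv.app c) =
      (shiftFunctorAdd' D 0 1 1 (zero_add 1)).inv.app (F.obj c) ≫
        Hom.f ((compShiftsIso F τ).hom.app c) 1 :=
    h.trans (congrArg (· ≫ _) (id_comp _))
  rw [shiftFunctorAdd'_zero_add_inv_app, shiftFunctorAdd'_zero_add_inv_app, Functor.map_comp,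
    assoc, map_shift_comp_inv, ← Functor.map_comp] at h'
  have h₃ := (cancel_epi _).1 h'
  refine h₃.symm.trans ?_
  simp

lemma compShiftsIso_inv_app_f_one (c : C) :
    Hom.f ((compShiftsIso F τ).inv.app c) 1 = τ.hom.app c := by
  have h := congrArg (fun φ => Hom.f φ (1 : ℤ)) ((compShiftsIso F τ).hom_inv_id_app c)
  have h' : τ.inv.app c ≫ Hom.f ((compShiftsIso F τ).inv.app c) 1 = 𝟙 _ := by
    rw [← compShiftsIso_hom_app_f_one]
    exact h
  exact (cancel_epi (τ.inv.app c)).1 (h'.trans (τ.inv_hom_id_app c).symm)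

end Orbit

/-- A functor that commutes with the shift by `1` commutes with the shift by `ℤ`. -/
@[reducible]
noncomputable def commShiftOfOne {C : Type u₁} [Category.{v₁} C] {D : Type u₂}
    [Category.{v₂} D] [HasShift C ℤ] [HasShift D ℤ] (F : C ⥤ D)
    (τ : shiftFunctor C (1 : ℤ) ⋙ F ≅ F ⋙ shiftFunctor D (1 : ℤ)) : F.CommShift ℤ :=
  Functor.CommShift.ofComp (Orbit.compShiftsIso F τ) ℤ

/-- The extension to `ℤ` does not alter the given `τ`. Triangles involve only the shift by 1, so
exactness can be tested on `τ` itself. Since `Orbit.shifts D` is faithful and orbit morphisms are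
determined at index 0, one component suffices. -/
lemma commShiftIso_commShiftOfOne {C : Type u₁} [Category.{v₁} C] {D : Type u₂}
    [Category.{v₂} D] [HasShift C ℤ] [HasShift D ℤ] (F : C ⥤ D)
    (τ : shiftFunctor C (1 : ℤ) ⋙ F ≅ F ⋙ shiftFunctor D (1 : ℤ)) :
    let _ := commShiftOfOne F τ
    F.commShiftIso (1 : ℤ) = τ := by
  let _ := commShiftOfOne F τ
  ext c
  apply (Orbit.shifts D).map_injective
  refine (Functor.CommShift.OfComp.map_iso_hom_app (Orbit.compShiftsIso F τ) (1 : ℤ) c).trans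
    (Orbit.ev_injective _ _ ?_)
  -- Index 0 of an orbit translated by 1 is index `1 + 0` of the orbit; there the inverse comparison
  -- is `τ.hom`, and all other factors are unit isomorphisms.
  have h : ((shiftFunctorZero D ℤ).hom.app (F.obj (c⟦(1 : ℤ)⟧)) ≫
        F.map ((shiftFunctorZero C ℤ).inv.app (c⟦(1 : ℤ)⟧))) ≫
      F.map ((shiftFunctorAdd' C 1 0 1 (add_zero 1)).inv.app c) ≫
      Orbit.Hom.f ((Orbit.compShiftsIso F τ).inv.app c) 1 ≫
      (shiftFunctorAdd' D 1 0 1 (add_zero 1)).hom.app (F.obj c) = (τ.hom.app c)⟦(0 : ℤ)⟧' := by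
    rw [Orbit.compShiftsIso_inv_app_f_one, shiftFunctorAdd'_add_zero_inv_app,
      shiftFunctorAdd'_add_zero_hom_app, assoc, ← F.map_comp_assoc, Iso.inv_hom_id_app,
      show F.map (𝟙 ((𝟭 C).obj (c⟦(1 : ℤ)⟧))) = 𝟙 _ from F.map_id _,
      ← cancel_mono ((shiftFunctorZero D ℤ).hom.app _)]
    refine (congrArg (· ≫ _) (congrArg (_ ≫ ·) (id_comp _))).trans ?_
    rw [assoc]
    refine (congrArg (_ ≫ ·) ((assoc _ _ _).trans
      ((congrArg (_ ≫ ·) (Iso.inv_hom_id_app _ _)).trans (comp_id _)))).trans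
      ((shiftFunctorZero D ℤ).hom.naturality (τ.hom.app c)).symm
  exact h

end CommShiftOfOne

/-! ### Stability under all integer shifts -/

section ShiftStability

variable {D : Type u} [Category.{v} D] [HasShift D ℤ]

/-- A property of objects that is closed under isomorphisms and both preserved and reflected by
the shift by `1` is stable under all shifts. -/
lemma isStableUnderShift_of_one (P : ObjectProperty D) [P.IsClosedUnderIsomorphisms]
    (hP : ∀ A : D, P (A⟦(1 : ℤ)⟧) ↔ P A) : P.IsStableUnderShift ℤ where
  isStableUnderShiftBy n :=
    { le_shift := fun A hA => by
        -- An equivalence, so that it serves both directions of the induction on `ℤ`.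
        have h (n : ℤ) : P (A⟦n + 1⟧) ↔ P (A⟦n⟧) :=
          (P.prop_iff_of_iso ((shiftFunctorAdd D n 1).app A)).trans (hP _)
        change P (A⟦n⟧)
        induction n using Int.induction_on with
        | zero => exact P.prop_of_iso ((shiftFunctorZero D ℤ).app A).symm hA
        | succ n hn => exact (h _).2 hn
        | pred n hn => exact (h _).1 (by simpa using hn) }

end ShiftStability

section

variable {K : Type u} [Category.{v} K]

lemma IsSummandClosedAdditive.prop_of_retract {C : ObjectProperty K}
    (hC : IsSummandClosedAdditive C) {X Y : K} (r : Retract X Y) (hY : C Y) : C X :=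
  have := hC.summand
  C.prop_of_retract r hY

end

variable {K : Type u} [Category.{v} K] [HasZeroObject K] [HasShift K ℤ] [Preadditive K]
  [∀ n : ℤ, (shiftFunctor K n).Additive] [Pretriangulated K]

namespace IsSummandClosedAdditive

variable {C : ObjectProperty K} (hC : IsSummandClosedAdditive C)
include hC

lemma prop_biprod {X Y : K} (hX : C X) (hY : C Y) : C (X ⊞ Y) :=
  have := hC.sum
  C.prop_of_isLimit_binaryFan (BinaryBiproduct.isLimit X Y) hX hY

lemma prop_of_biprod {X Y : K} (h : C (X ⊞ Y)) : C X :=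
  hC.prop_of_retract ⟨biprod.inl, biprod.fst, biprod.inl_fst⟩ h

end IsSummandClosedAdditive

lemma IsThick.isSummandClosedAdditive {C : ObjectProperty K} (hC : IsThick C) :
    IsSummandClosedAdditive C := by
  have := hC.triangulated
  have := hC.summand
  exact ⟨inferInstance, inferInstance, inferInstance⟩

/-! ### The dictionary between `C` and its image in the stable category -/

namespace FrobeniusClass

variable (E : FrobeniusClass K)

/-- Lifting the retraction gives `𝟙 X = i ≫ p + a ≫ b` with `a ≫ b` passing through a projective
`J`; the pairs `(i, a)` and `(p, b)` then exhibit `X` as a summand of `Y ⊞ J`. -/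
lemma retract_of_retract_π {X Y : K} (r : Retract (E.π.obj X) (E.π.obj Y)) :
    ∃ J : K, E.proj J ∧ Nonempty (Retract X (Y ⊞ J)) := by
  obtain ⟨i, hi⟩ := E.π.map_surjective r.i
  obtain ⟨p, hp⟩ := E.π.map_surjective r.r
  obtain ⟨J, a, b, hJ, h⟩ := (E.π_map_eq_iff_relation (𝟙 X) (i ≫ p)).1
    (by rw [E.π.map_id, E.π.map_comp, hi, hp, r.retract])
  exact ⟨J, hJ, ⟨biprod.lift i a, biprod.desc p b, by
    rw [biprod.lift_desc, ← h]; abel⟩⟩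

variable {C : ObjectProperty K}

/-- An isomorphism in the stable category is in particular a retraction, so `X` is a summand of `Y ⊞
J` with `Y` in `C` and `J` projective. Membership in `π(C)` can therefore be tested in `K`. -/
lemma map_π_obj_iff (hC : IsSummandClosedAdditive C) (hP : E.proj ≤ C) (X : K) :
    C.map E.π (E.π.obj X) ↔ C X := by
  refine ⟨?_, C.prop_map_obj E.π⟩
  rintro ⟨Y, hY, ⟨e⟩⟩
  obtain ⟨J, hJ, ⟨r⟩⟩ := E.retract_of_retract_π e.symm.retract
  exact hC.prop_of_retract r (hC.prop_biprod hY (hP _ hJ))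

lemma isStableUnderRetracts_map_π (hC : IsSummandClosedAdditive C) (hP : E.proj ≤ C) :
    (C.map E.π).IsStableUnderRetracts where
  of_retract {A B} r hB := by
    obtain ⟨X, rfl⟩ : ∃ X : K, E.π.obj X = A := ⟨A.as, rfl⟩
    obtain ⟨Y, rfl⟩ : ∃ Y : K, E.π.obj Y = B := ⟨B.as, rfl⟩
    rw [E.map_π_obj_iff hC hP] at hB ⊢
    obtain ⟨J, hJ, ⟨r⟩⟩ := E.retract_of_retract_π r
    exact hC.prop_of_retract r (hC.prop_biprod hB (hP _ hJ))

lemma proj_env (X : K) : E.proj (E.env X) := E.proj_of_inj (E.inj_env X)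

/-- The stable suspension of `X` is `X'`, and in the triangle `X ⟶ I_X ⟶ X'` of `E` the middle term
always lies in `C`. -/
lemma shift_map_π_iff (hC : IsSummandClosedAdditive C) (hP : E.proj ≤ C)
    (h : E.TwoOutOfThree C) (A : E.Stable) : C.map E.π (A⟦(1 : ℤ)⟧) ↔ C.map E.π A := by
  obtain ⟨X, rfl⟩ : ∃ X : K, E.π.obj X = A := ⟨A.as, rfl⟩
  refine (E.map_π_obj_iff hC hP (E.cosyz X)).trans (Iff.trans ?_ (E.map_π_obj_iff hC hP X).symm)
  exact ⟨fun hX => h.first _ (E.tri_env X) (hP _ (E.proj_env X)) hX,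
    fun hX => h.third _ (E.tri_env X) hX (hP _ (E.proj_env X))⟩

lemma twoOutOfThree_of_isThick (hC : IsThick C) : E.TwoOutOfThree C := by
  have := hC.triangulated
  have := hC.summand
  exact ⟨fun T hT => C.ext_of_isTriangulatedClosed₃ T (E.distinguished T hT),
    fun T hT => C.ext_of_isTriangulatedClosed₂ T (E.distinguished T hT),
    fun T hT => C.ext_of_isTriangulatedClosed₁ T (E.distinguished T hT)⟩

lemma proj_nonempty : E.proj.Nonempty := ⟨⟨E.env 0, E.proj_env 0⟩⟩

variable [IsTriangulated K]

/-- With stability under shifts, closure at the middle object is enough. A stable triangle on `f : X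
⟶ Y` with cone `Z` yields the triangle `Y ⟶ Z ⟶ X'` of `E`; `X'` lies in `C` because `X` does, hence
so does `Y`. -/
lemma isThick_map_π (hC : IsSummandClosedAdditive C) (hP : E.proj ≤ C) (h : E.TwoOutOfThree C) :
    IsThick (C.map E.π) := by
  have h₀ := E.isStableUnderRetracts_map_π hC hP
  have h₁ : (C.map E.π).IsStableUnderShift ℤ :=
    isStableUnderShift_of_one _ (E.shift_map_π_iff hC hP h)
  have h₂ : (C.map E.π).IsTriangulatedClosed₂ := .mk' (by
    rintro T ⟨X, Y, Z, f, g, w, ⟨_, -, -, H⟩, ⟨e⟩⟩ hT₁ hT₃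
    have hX := (E.map_π_obj_iff hC hP X).1
      ((C.map E.π).prop_of_iso (Triangle.π₁.mapIso e) hT₁)
    have hZ := (E.map_π_obj_iff hC hP Z).1
      ((C.map E.π).prop_of_iso (Triangle.π₃.mapIso e) hT₃)
    have hY : C Y := h.first _ (E.tri_of_isPhantom H (E.isPhantom_δ_comp f)) hZ
      (h.third _ (E.tri_env X) hX (hP _ (E.proj_env X)) : C (E.cosyz X))
    exact (C.map E.π).prop_of_iso (Triangle.π₂.mapIso e).symm (C.prop_map_obj E.π hY))
  have h₃ : (C.map E.π).ContainsZero :=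
    ⟨⟨E.π.obj (E.env 0), E.isZero_of_proj (E.proj_env 0),
      C.prop_map_obj E.π (hP _ (E.proj_env 0))⟩⟩
  exact ⟨{ }, h₀⟩

lemma exists_π_distinguished {T : Triangle K} (hT : E.tri T) :
    ∃ w : E.π.obj T.obj₃ ⟶ (E.π.obj T.obj₁)⟦(1 : ℤ)⟧,
      Triangle.mk (E.π.map T.mor₁) (E.π.map T.mor₂) w ∈ distTriang E.Stable := by
  obtain ⟨s, hs⟩ := E.exists_lift_δ ⟨_, _, _, hT⟩
  exact ⟨_, E.imageTriangle_mem_of_tri (f := T.mor₁) (g := T.mor₂) (h := T.mor₃) hT s hs⟩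

lemma twoOutOfThree_of_isThick_map_π (hC : IsSummandClosedAdditive C) (hP : E.proj ≤ C)
    (h : IsThick (C.map E.π)) : E.TwoOutOfThree C := by
  have := h.triangulated
  have := h.summand
  constructor
  all_goals
    intro T hT h₁ h₂
    obtain ⟨w, hw⟩ := E.exists_π_distinguished hT
    rw [← E.map_π_obj_iff hC hP] at h₁ h₂ ⊢
  · exact (C.map E.π).ext_of_isTriangulatedClosed₃ _ hw h₁ h₂
  · exact (C.map E.π).ext_of_isTriangulatedClosed₂ _ hw h₁ h₂
  · exact (C.map E.π).ext_of_isTriangulatedClosed₁ _ hw h₁ h₂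

/-- Every distinguished triangle is the quotient of a triangle of the class by a
projective-injective object. -/
lemma exists_tri_of_distinguished {X Y Z : K} {f : X ⟶ Y} {g : Y ⟶ Z} {h : Z ⟶ X⟦(1 : ℤ)⟧}
    (H : Triangle.mk f g h ∈ distTriang K) :
    ∃ (Z' : K) (k : Y ⊞ E.env X ⟶ Z') (w : Z' ⟶ X⟦(1 : ℤ)⟧) (q : Z' ⟶ Z)
      (r : Z ⟶ (E.env X)⟦(1 : ℤ)⟧) (t : (E.env X)⟦(1 : ℤ)⟧ ⟶ Z'⟦(1 : ℤ)⟧),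
      E.tri (Triangle.mk (biprod.lift f (E.ι X)) k w) ∧ k ≫ q = biprod.fst ≫ g ∧ q ≫ h = w ∧
        Triangle.mk q r t ∈ distTriang K := by
  obtain ⟨Z', k, w, hZ⟩ := distinguished_cocone_triangle (biprod.lift f (E.ι X))
  have h₁ : Triangle.mk (biprod.inr : E.env X ⟶ Y ⊞ E.env X) (biprod.fst : Y ⊞ E.env X ⟶ Y) 0 ∈
      distTriang K :=
    dist_of_iso (binaryBiproductTriangle_distinguished (E.env X) Y) (Iso.refl _)
      (biprod.braiding _ _) (Iso.refl _) (by ext <;> simp) (by simp) (by simp)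
  -- Octahedron on `X ⟶ Y ⊞ I_X ⟶ Y`, whose composite is `f`; the rotated split triangle identifies
  -- the cone of the projection with `I_X⟦1⟧`.
  let o := Triangulated.someOctahedron (biprod.lift_fst f (E.ι X)) hZ (dist_rot.1 h₁) H
  exact ⟨Z', k, w, o.m₁, o.m₃, _, E.tri_of_extends hZ biprod.snd (biprod.lift_snd _ _), o.comm₁,
    o.comm₂, o.mem⟩

/-! ### Thickness in `K` and the thick closure of the projectives -/

lemma isThick_triangEnvelope_proj : IsThick E.proj.triangEnvelope :=
  have := E.proj_nonempty
  ⟨inferInstance, inferInstance⟩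

/-- Two-out-of-three is available only for triangles of `E`. The hypothesis on the envelope `M` of
the projectives bridges the gap: `C` is first shown to be invariant under morphisms with cone in
`M`, and the error terms `I_X⟦1⟧` lie in `M`. -/
lemma isThick_of_triangEnvelope_proj_le (hC : IsSummandClosedAdditive C) (h : E.TwoOutOfThree C)
    (hM : E.proj.triangEnvelope ≤ C) : IsThick C := by
  have hP : E.proj ≤ C := E.proj.le_triangEnvelope.trans hM
  have hT := E.isThick_triangEnvelope_proj
  have := hT.triangulated
  have hI (X : K) : E.proj.triangEnvelope (E.env X) := E.proj.le_triangEnvelope _ (E.proj_env X)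
  have hI' (X : K) : E.proj.triangEnvelope ((E.env X)⟦(1 : ℤ)⟧) :=
    E.proj.triangEnvelope.le_shift 1 _ (hI X)
  -- If `Z` is in `M`, then so is `Z'`, by `Z' ⟶ Z ⟶ I_X⟦1⟧`; now two-out-of-three applies to the
  -- triangle `X ⟶ Y ⊞ I_X ⟶ Z'` of `E`.
  have key {X Y Z : K} {f : X ⟶ Y} {g : Y ⟶ Z} {w : Z ⟶ X⟦(1 : ℤ)⟧}
      (H : Triangle.mk f g w ∈ distTriang K) (hZ : E.proj.triangEnvelope Z) : C X ↔ C Y := by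
    obtain ⟨Z', k, w', q, r, t, T, -, -, H'⟩ := E.exists_tri_of_distinguished H
    have hZ' : C Z' := hM _
      (E.proj.triangEnvelope.ext_of_isTriangulatedClosed₁ _ H' hZ (hI' X))
    exact ⟨fun hX => hC.prop_of_biprod (h.second _ T hX hZ'),
      fun hY => h.first _ T (hC.prop_biprod hY (hP _ (E.proj_env X))) hZ'⟩
  have h₀ := hC.summand
  -- The doubly rotated preenvelope triangle begins `X' ⟶ X⟦1⟧ ⟶ I_X⟦1⟧`, so `key` compares `X'`
  -- with `X⟦1⟧`.
  have h₁ : C.IsStableUnderShift ℤ := isStableUnderShift_of_one _ fun X =>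
    (key (rot_of_distTriang _ (rot_of_distTriang _ (E.dist_env X))) (hI' X)).symm.trans
      ⟨fun hX => h.first _ (E.tri_env X) (hP _ (E.proj_env X)) hX,
        fun hX => h.third _ (E.tri_env X) hX (hP _ (E.proj_env X))⟩
  have h₂ : C.IsTriangulatedClosed₃ := .mk' (by
    intro T hT h₁ h₂
    obtain ⟨Z', k, w', q, r, t, T', -, -, H'⟩ :=
      E.exists_tri_of_distinguished (f := T.mor₁) (g := T.mor₂) (h := T.mor₃) hT
    -- `Z'` lies in `C` by two-out-of-three, and `Z' ⟶ Z` has cone `I_X⟦1⟧` in `M`.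
    exact (key H' (hI' _)).1
      (h.third _ T' h₁ (hC.prop_biprod h₂ (hP _ (E.proj_env _)))))
  have h₃ := hC.zero
  exact ⟨{ toIsTriangulatedClosed₂ := .of_isTriangulatedClosed₃ }, h₀⟩

lemma isThick_iff_triangEnvelope_proj_le (hC : IsSummandClosedAdditive C) (hP : E.proj ≤ C)
    (h : E.TwoOutOfThree C) : IsThick C ↔ E.proj.triangEnvelope ≤ C := by
  refine ⟨fun hC' => ?_, E.isThick_of_triangEnvelope_proj_le hC h⟩
  have := hC'.triangulated
  have := hC'.summand
  exact (E.proj.triangEnvelope_le_iff).2 hP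

end FrobeniusClass

/-! ### The Verdier quotients as localizations of `K` -/

namespace FrobeniusClass

variable (E : FrobeniusClass K)

lemma isIso_π_map_fst (X : K) {J : K} (hJ : E.proj J) :
    IsIso (E.π.map (biprod.fst : X ⊞ J ⟶ X)) := by
  have hz : E.π.map (biprod.snd : X ⊞ J ⟶ J) = 0 := (E.isZero_of_proj hJ).eq_of_tgt _ _
  refine ⟨E.π.map biprod.inl, ?_, by rw [← E.π.map_comp, biprod.inl_fst, E.π.map_id]⟩
  rw [← E.π.map_id, ← biprod.total, E.π.map_add, E.π.map_comp biprod.snd, hz, zero_comp,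
    add_zero, E.π.map_comp]

/-- The relative stable category is the localization of `K` at the stable equivalences. -/
instance isLocalization_π :
    E.π.IsLocalization ((MorphismProperty.isomorphisms E.Stable).inverseImage E.π) := by
  refine E.π.isLocalization_of_essSurj_of_full_of_exists_cylinders _ (fun _ _ _ h => h) ?_
  intro X Y f₀ f₁ h
  obtain ⟨J, a, b, hJ, h⟩ := (E.π_map_eq_iff_relation f₀ f₁).1 h
  -- When `f₀ - f₁ = a ≫ b` passes through `J`, the object `X ⊞ J` is a cylinder: `(1, a)` and `(1,
  -- 0)` both split the projection, which is a stable equivalence, and the homotopy `(f₁, b)`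
  -- restricts to `f₀` and `f₁`.
  exact ⟨{ I := X ⊞ J, i₀ := biprod.lift (𝟙 X) a, i₁ := biprod.inl, π := biprod.fst },
    { h := biprod.desc f₁ b
      h₀ := by rw [biprod.lift_desc, ← h, id_comp]; abel
      h₁ := biprod.inl_desc _ _ }, E.isIso_π_map_fst X hJ⟩

/-- The cone is `I_X⟦1⟧`. The sign anticipates the one in `imageTriangle_mem_of_tri`. -/
lemma trW_neg_δ {C : ObjectProperty K} [C.IsTriangulated] (hP : E.proj ≤ C) (X : K) :
    C.trW (-E.δ X) :=
  ⟨_, _, _, dist_neg₁₂ (dist_rot.1 (dist_rot.1 (E.dist_env X))),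
    C.le_shift 1 _ (hP _ (E.proj_env X))⟩

variable [IsTriangulated K] {C : ObjectProperty K}

/-- In the stable category `f` agrees with `(f, ι_X)` up to the isomorphism induced by the
projection, and for `(f, ι_X)` the same object `Z'` is a cone in both categories. In `K` the cones
`Z` and `Z'` differ by `I_X⟦1⟧`, which lies in `C`. -/
lemma trW_π_map_iff (hC : IsThick C) (hP : E.proj ≤ C) {X Y : K} (f : X ⟶ Y) :
    (C.map E.π).trW (E.π.map f) ↔ C.trW f := by
  have := hC.triangulated
  have := hC.summand
  have := E.isStableUnderRetracts_map_π hC.isSummandClosedAdditive hP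
  obtain ⟨Z, g, h, H⟩ := distinguished_cocone_triangle f
  obtain ⟨Z', k, w, q, r, t, T, -, -, H'⟩ := E.exists_tri_of_distinguished H
  obtain ⟨s, hs⟩ := E.exists_π_distinguished T
  have := E.isIso_π_map_fst Y (E.proj_env X)
  have hI : C ((E.env X)⟦(1 : ℤ)⟧) := C.le_shift 1 _ (hP _ (E.proj_env X))
  have e₁ : C Z ↔ C Z' :=
    ⟨fun hZ => C.ext_of_isTriangulatedClosed₁ _ H' hZ hI,
      fun hZ' => C.ext_of_isTriangulatedClosed₁ _ (rot_of_distTriang _ H') hI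
        (C.le_shift 1 _ hZ')⟩
  have e₂ : (C.map E.π).trW (E.π.map (biprod.lift f (E.ι X))) ↔ C.map E.π (E.π.obj Z') :=
    (C.map E.π).trW_iff_of_distinguished _ hs
  have e₃ : C.trW f ↔ C Z' := (C.trW_iff_of_distinguished _ H).trans e₁
  rw [e₃,
    ← E.map_π_obj_iff hC.isSummandClosedAdditive hP, ← e₂,
    ← (C.map E.π).trW.cancel_right_of_respectsIso (E.π.map (biprod.lift f (E.ι X)))
      (E.π.map biprod.fst), ← E.π.map_comp, biprod.lift_fst]

variable (C) in
/-- The composition of the functor `π` with the localization functor to the Verdier quotient of the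
relative stable category. -/
noncomputable abbrev πQ : K ⥤ (C.map E.π).trW.Localization := E.π ⋙ (C.map E.π).trW.Q

/-- A composite of two localizations. By `trW_π_map_iff`, `C.trW` contains the stable equivalences
and, as `π` is full, its image exhausts the morphisms inverted by the second localization. -/
lemma isLocalization_πQ [C.IsTriangulated] (hC : IsThick C) (hP : E.proj ≤ C) :
    (E.πQ C).IsLocalization C.trW := by
  refine Functor.IsLocalization.comp E.π (C.map E.π).trW.Q
    ((MorphismProperty.isomorphisms E.Stable).inverseImage E.π) (C.map E.π).trW C.trW ?_ ?_ ?_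
  · intro X Y f hf
    exact Localization.inverts (C.map E.π).trW.Q (C.map E.π).trW _
      ((E.trW_π_map_iff hC hP f).2 hf)
  · intro X Y f hf
    have : IsIso (E.π.map f) := hf
    exact (E.trW_π_map_iff hC hP f).1 ((C.map E.π).trW_of_isIso _)
  · intro A B φ hφ
    obtain ⟨X, rfl⟩ : ∃ X : K, E.π.obj X = A := ⟨A.as, rfl⟩
    obtain ⟨Y, rfl⟩ : ∃ Y : K, E.π.obj Y = B := ⟨B.as, rfl⟩
    obtain ⟨f, rfl⟩ := E.π.map_surjective φ
    exact C.trW.map_mem_map E.π f ((E.trW_π_map_iff hC hP f).1 hφ)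

lemma isIso_πQ_map [C.IsTriangulated] (hC : IsThick C) (hP : E.proj ≤ C) {X Y : K} {f : X ⟶ Y}
    (hf : C.trW f) : IsIso ((E.πQ C).map f) :=
  have := E.isLocalization_πQ hC hP
  Localization.inverts (E.πQ C) C.trW f hf

/-- The negative of the connecting morphism becomes an isomorphism in the Verdier quotient. -/
noncomputable def δIso [C.IsTriangulated] (hC : IsThick C) (hP : E.proj ≤ C) (X : K) :
    (E.πQ C).obj (E.cosyz X) ≅ (E.πQ C).obj (X⟦(1 : ℤ)⟧) :=
  have := E.isIso_πQ_map hC hP (E.trW_neg_δ hP X)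
  asIso ((E.πQ C).map (-E.δ X))

lemma δIso_hom [C.IsTriangulated] (hC : IsThick C) (hP : E.proj ≤ C) (X : K) :
    (E.δIso hC hP X).hom = (E.πQ C).map (-E.δ X) := rfl

/-! ### Exactness of the functor to the quotient and of the induced equivalence -/

variable [C.IsTriangulated] [(C.map E.π).IsTriangulated] (hC : IsThick C) (hP : E.proj ≤ C)
include hC hP

/-- The functor to the Verdier quotient of the relative stable category commutes with the
shift by `1`. -/
noncomputable def πQShiftIso : shiftFunctor K (1 : ℤ) ⋙ E.πQ C ≅
    E.πQ C ⋙ shiftFunctor (C.map E.π).trW.Localization (1 : ℤ) :=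
  NatIso.ofComponents
    (fun X => (E.δIso hC hP X).symm ≪≫
      ((C.map E.π).trW.Q.commShiftIso (1 : ℤ)).app (E.π.obj X))
    (fun {X Y} f => by
      obtain ⟨s, hs⟩ := E.exists_susp f
      -- The representative `s` of the suspended morphism satisfies `s ≫ δ_Y = δ_X ≫ f⟦1⟧`, which is
      -- naturality of `-δ`.
      have h₁ : (E.πQ C).map (f⟦(1 : ℤ)⟧') ≫ (E.δIso hC hP Y).inv =
          (E.δIso hC hP X).inv ≫ (E.πQ C).map s := by
        rw [Iso.comp_inv_eq, assoc, Iso.eq_inv_comp, δIso_hom, δIso_hom, ← Functor.map_comp,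
          ← Functor.map_comp, Preadditive.comp_neg, hs, Preadditive.neg_comp]
      have h₂ := ((C.map E.π).trW.Q.commShiftIso (1 : ℤ)).hom.naturality (E.π.map f)
      have h₃ : (shiftFunctor E.Stable (1 : ℤ) ⋙ (C.map E.π).trW.Q).map (E.π.map f) =
          (E.πQ C).map s := congrArg (C.map E.π).trW.Q.map (E.shift_map_eq f s hs)
      refine (assoc _ _ _).symm.trans ((congrArg (· ≫ _) h₁).trans ?_)
      refine (assoc _ _ _).trans (Eq.trans ?_ (assoc _ _ _).symm)
      exact congrArg (_ ≫ ·) ((congrArg (· ≫ _) h₃.symm).trans h₂))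

/-- Dividing `s ≫ δ_X` by `-δ_X` leaves `-s`, the third map of the stable triangle attached to a
triangle of `E`. With `+δ_X` the functor would be exact only up to sign. -/
lemma map_comp_πQShiftIso_hom_app {X Z : K} (s : Z ⟶ E.cosyz X) :
    (E.πQ C).map (s ≫ E.δ X) ≫ (E.πQShiftIso hC hP).hom.app X =
      (E.πQ C).map (-s) ≫ ((C.map E.π).trW.Q.commShiftIso (1 : ℤ)).hom.app (E.π.obj X) := by
  have h : (E.πQ C).map (s ≫ E.δ X) = (E.πQ C).map (-s) ≫ (E.δIso hC hP X).hom := by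
    rw [δIso_hom, ← Functor.map_comp, Preadditive.neg_comp_neg]
  refine (congrArg (· ≫ _) h).trans ((assoc _ _ _).trans (congrArg (_ ≫ ·) ?_))
  exact Iso.hom_inv_id_assoc _ _

/-- Compare the triangle with the triangle of `E` on `(f, ι_X)`. The comparison has components the
identity, a projection with kernel `I_X`, and `q` with cone `I_X⟦1⟧`; all become invertible in the
quotient, and the triangle of `E` has distinguished image. -/
lemma isTriangulated_πQ :
    let _ := commShiftOfOne (E.πQ C) (E.πQShiftIso hC hP)
    (E.πQ C).IsTriangulated := by
  let _ := commShiftOfOne (E.πQ C) (E.πQShiftIso hC hP)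
  have hτ : (E.πQ C).commShiftIso (1 : ℤ) = E.πQShiftIso hC hP :=
    commShiftIso_commShiftOfOne _ _
  constructor
  rintro ⟨X, Y, Z, f, g, h⟩ H
  obtain ⟨Z', k, w, q, r, t, T, hk, hq, H'⟩ := E.exists_tri_of_distinguished H
  obtain ⟨s, hs⟩ := E.exists_lift_δ ⟨_, _, _, T⟩
  have D := (C.map E.π).trW.Q.map_distinguished _ (E.imageTriangle_mem_of_tri T s hs)
  let φ : Triangle.mk (biprod.lift f (E.ι X)) k w ⟶ Triangle.mk f g h :=
    { hom₁ := 𝟙 X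
      hom₂ := biprod.fst
      hom₃ := q
      comm₁ := (biprod.lift_fst _ _).trans (id_comp _).symm
      comm₂ := hk
      comm₃ := (congrArg (w ≫ ·) (CategoryTheory.Functor.map_id _ _)).trans
        ((comp_id _).trans hq.symm) }
  have h₂ : IsIso ((E.πQ C).map (biprod.fst : Y ⊞ E.env X ⟶ Y)) :=
    have := E.isIso_π_map_fst Y (E.proj_env X)
    inferInstanceAs (IsIso ((C.map E.π).trW.Q.map (E.π.map _)))
  have h₃ : IsIso ((E.πQ C).map q) :=
    E.isIso_πQ_map hC hP ⟨_, _, _, H', C.le_shift 1 _ (hP _ (E.proj_env X))⟩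
  have : IsIso ((E.πQ C).mapTriangle.map φ) := Triangle.isIso_of_isIsos _
    (inferInstanceAs (IsIso ((E.πQ C).map (𝟙 X)))) h₂ h₃
  refine isomorphic_distinguished _ D _ ((asIso ((E.πQ C).mapTriangle.map φ)).symm ≪≫
    Triangle.isoMk _ _ (Iso.refl _) (Iso.refl _) (Iso.refl _)
      ((comp_id _).trans (id_comp _).symm) ((comp_id _).trans (id_comp _).symm) ?_)
  have key : (E.πQ C).map w ≫ ((E.πQ C).commShiftIso (1 : ℤ)).hom.app X =
      (E.πQ C).map (-s) ≫ ((C.map E.π).trW.Q.commShiftIso (1 : ℤ)).hom.app (E.π.obj X) := by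
    rw [hτ, ← hs]
    exact E.map_comp_πQShiftIso_hom_app hC hP s
  exact (congrArg (_ ≫ ·) (CategoryTheory.Functor.map_id _ _)).trans
    ((comp_id _).trans (key.trans (id_comp _).symm))

/-- Both `C.trW.Q` and `E.πQ C` localize `K` at `C.trW`, so the comparison functor is an
equivalence; its shift structure and exactness descend from those of `E.πQ C`. -/
lemma inducesExactEquivalence : E.InducesExactEquivalence C := by
  let _ := commShiftOfOne (E.πQ C) (E.πQShiftIso hC hP)
  have := E.isTriangulated_πQ hC hP
  have := E.isLocalization_πQ hC hP
  let F := (Localization.uniq C.trW.Q (E.πQ C) C.trW).functor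
  let e : C.trW.Q ⋙ F ≅ E.πQ C := Localization.compUniqFunctor C.trW.Q (E.πQ C) C.trW
  let _ : Localization.Lifting C.trW.Q C.trW (E.πQ C) F := ⟨e⟩
  let _ := Functor.commShiftOfLocalization C.trW.Q C.trW ℤ (E.πQ C) F
  -- Every arrow of the quotient is, up to isomorphism, the image of an arrow of `K`; exactness can
  -- therefore be checked after precomposition with `C.trW.Q`.
  have := Localization.essSurj_mapArrow C.trW.Q C.trW
  refine ⟨F, ⟨e⟩, inferInstance, inferInstance, ?_⟩
  exact Functor.isTriangulated_of_precomp_iso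
    (Localization.Lifting.iso C.trW.Q C.trW (E.πQ C) F)

end FrobeniusClass

end RelStable

theorem mainTheorem3 {K : Type u} [Category.{v} K] [HasZeroObject K] [HasShift K ℤ]
    [Preadditive K] [∀ n : ℤ, (shiftFunctor K n).Additive] [Pretriangulated K] [IsTriangulated K]
    (E : RelStable.FrobeniusClass K) :
    (∀ C : ObjectProperty K, RelStable.IsSummandClosedAdditive C → E.proj ≤ C →
      (E.TwoOutOfThree C ↔ RelStable.IsThick (C.map E.π)) ∧
      (E.TwoOutOfThree C → (RelStable.IsThick C ↔ E.proj.triangEnvelope ≤ C))) ∧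
    (∀ C : ObjectProperty K, RelStable.IsThick C → E.proj ≤ C →
      RelStable.IsThick (C.map E.π) ∧
      ∃ (_ : C.IsTriangulated) (_ : (C.map E.π).IsTriangulated), E.InducesExactEquivalence C) ∧
    (RelStable.IsThick E.proj.triangEnvelope ∧
      RelStable.IsThick (E.proj.triangEnvelope.map E.π) ∧
      ∃ (_ : E.proj.triangEnvelope.IsTriangulated)
        (_ : (E.proj.triangEnvelope.map E.π).IsTriangulated),
        E.InducesExactEquivalence E.proj.triangEnvelope) := by
  have key (C : ObjectProperty K) (hC : RelStable.IsThick C) (hP : E.proj ≤ C) :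
      RelStable.IsThick (C.map E.π) ∧ ∃ (_ : C.IsTriangulated) (_ : (C.map E.π).IsTriangulated),
        E.InducesExactEquivalence C := by
    have h := E.isThick_map_π hC.isSummandClosedAdditive hP (E.twoOutOfThree_of_isThick hC)
    have := hC.triangulated
    have := h.triangulated
    exact ⟨h, inferInstance, inferInstance, E.inducesExactEquivalence hC hP⟩
  exact ⟨fun C hC hP => ⟨⟨E.isThick_map_π hC hP, E.twoOutOfThree_of_isThick_map_π hC hP⟩,
    E.isThick_iff_triangEnvelope_proj_le hC hP⟩, key, E.isThick_triangEnvelope_proj,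
    key _ E.isThick_triangEnvelope_proj E.proj.le_triangEnvelope⟩
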